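/- Let $I=(0,1)$ and $m\in\mathbb Z$. For complex-valued functions $u,v$ on $I$ put $$\mathcal A_m(u,v)=\int_0^1\Big[u''+\frac{u'}{r}-\frac{m^2}{r^2}u\Big]\Big[\overline v''+\frac{\overline v'}{r}-\frac{m^2}{r^2}\overline v\Big]\,r\,dr,\qquad \mathcal B_m(u,v)=\int_0^1\Big(r\,u'\,\overline v'+\frac{m^2}{r}u\,\overline v\Big)dr,$$ and let $H_m$ be the space of all functions $u$ on $I$ such that $u$ is differentiable with $u'$ locally absolutely continuous on $I$, $\mathcal A_m(u,u)<\infty$ and $m\,u(0)=(1-m^2)\,u'(0)=u(1)=u'(1)=0$ (boundary values in the sense of one-sided limits). For $N\ge 0$ let $X_N^m$ be the space of those elements of $H_m$ that are (restrictions to $I$ of) polynomials of degree at most $N$. For $V=H_m$ and for $V=X_N^m$ consider the eigenvalue problem: find $(\lambda,\psi)\in\mathbb R\times V$ with $\mathcal B_m(\psi,\psi)=1$ and $$\mathcal A_m(\psi,v)=\lambda\,\mathcal B_m(\psi,v)\qquad\text{for all } v\in V .$$ Denote by $\lambda_m^1\le\lambda_m^2\le\cdots$ the eigenvalues for $V=H_m$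 and by $\lambda_{mN}^1\le\lambda_{mN}^2\le\cdots$ those for $V=X_N^m$ (the Galerkin scheme), in ascending order and counted with multiplicity. Let $\Pi_N^{2,m}:H_m\to X_N^m$ be the $\mathcal A_m$-orthogonal projection, $\mathcal A_m(u-\Pi_N^{2,m}u,v)=0$ for all $v\in X_N^m$. Theorem. Let $1\le l\le\dim X_N^m$. Then there are linearly independent eigenfunctions $\psi_m^1,\dots,\psi_m^l\in H_m$ for $\lambda_m^1,\dots,\lambda_m^l$, and for every such choice, with $E_{1,l}=\operatorname{span}\{\psi_m^1,\dots,\psi_m^l\}$, $$0<\lambda_m^l\le\lambda_{mN}^l\le\lambda_m^l\max_{0\ne v\in E_{1,l}}\frac{\mathcal B_m(v,v)}{\mathcal B_m(\Pi_N^{2,m}v,\Pi_N^{2,m}v)},$$ where a quotient with $\Pi_N^{2,m}v=0$ has the value $+\infty$; the maximum is attained in $(0,+\infty]$. -/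

import Mathlib

open MeasureTheory Set Filter Topology
open scoped ComplexConjugate ENNReal

noncomputable section

namespace StokesDisk

/-! Functions on `I = (0,1)` are modelled as functions `ℝ → ℂ` that vanish outside `(0,1)`, so that
two of them are equal exactly when they agree on `(0,1)`. Derivatives are only ever used at points
of the open interval `(0,1)`, and boundary values are one-sided limits taken inside `(0,1)`. -/

/-- The radial Laplacian of the Fourier mode `m`: `u'' + u'/r - m² u / r²`. -/
def radialLaplacian (m : ℤ) (u : ℝ → ℂ) (r : ℝ) : ℂ :=
  deriv (deriv u) r + deriv u r / (r : ℂ) - (m : ℂ) ^ 2 / (r : ℂ) ^ 2 * u r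

/-- `𝒜ₘ(u,v) = ∫₀¹ [u'' + u'/r - m² u/r²] [v̄'' + v̄'/r - m² v̄/r²] r dr`. -/
def formA (m : ℤ) (u v : ℝ → ℂ) : ℂ :=
  ∫ r in Ioo (0 : ℝ) 1, radialLaplacian m u r * conj (radialLaplacian m v r) * (r : ℂ)

/-- `ℬₘ(u,v) = ∫₀¹ (r u' v̄' + m² u v̄ / r) dr`. -/
def formB (m : ℤ) (u v : ℝ → ℂ) : ℂ :=
  ∫ r in Ioo (0 : ℝ) 1,
    ((r : ℂ) * deriv u r * conj (deriv v r) + (m : ℂ) ^ 2 / (r : ℂ) * u r * conj (v r))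

/-- Membership in the weighted Sobolev space `H̊²ₘ(I)`: `u` has a locally absolutely continuous
first derivative on `(0,1)` (so `u''` exists almost everywhere and is the weak second derivative),
`𝒜ₘ(u,u) < ∞`, and `m u(0) = (1 - m²) u'(0) = u(1) = u'(1) = 0`. -/
structure MemH2 (m : ℤ) (u : ℝ → ℂ) : Prop where
  eq_zero_outside : ∀ r, r ∉ Ioo (0 : ℝ) 1 → u r = 0
  differentiableOn : DifferentiableOn ℝ u (Ioo 0 1)
  locally_ac_deriv : ∀ a b : ℝ, 0 < a → a < b → b < 1 →
    AbsolutelyContinuousOnInterval (deriv u) a b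
  finite_energy : IntegrableOn (fun r => ‖radialLaplacian m u r‖ ^ 2 * r) (Ioo 0 1)
  pole_value : Tendsto (fun r => (m : ℂ) * u r) (𝓝[>] 0) (𝓝 0)
  pole_deriv : Tendsto (fun r => (1 - (m : ℂ) ^ 2) * deriv u r) (𝓝[>] 0) (𝓝 0)
  boundary_value : Tendsto u (𝓝[<] 1) (𝓝 0)
  boundary_deriv : Tendsto (deriv u) (𝓝[<] 1) (𝓝 0)

theorem MemH2.differentiableAt {m : ℤ} {u : ℝ → ℂ} (h : MemH2 m u) {r : ℝ}
    (hr : r ∈ Ioo (0 : ℝ) 1) : DifferentiableAt ℝ u r :=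
  h.differentiableOn.differentiableAt (isOpen_Ioo.mem_nhds hr)

theorem MemH2.ae_differentiableAt_deriv {m : ℤ} {u : ℝ → ℂ} (h : MemH2 m u) :
    ∀ᵐ r, r ∈ Ioo (0 : ℝ) 1 → DifferentiableAt ℝ (deriv u) r := by
  have hbv : LocallyBoundedVariationOn (deriv u) (Ioo 0 1) := by
    intro a b ha hb
    rcases lt_or_ge a b with hab | hab
    · have := (h.locally_ac_deriv a b ha.1 hab hb.2).boundedVariationOn
      rw [uIcc_of_le hab.le] at this
      exact this.mono inter_subset_right
    · refine (eVariationOn.subsingleton _ ?_).trans_ne ENNReal.zero_ne_top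
      exact (Set.subsingleton_Icc_of_ge hab).anti inter_subset_right
  filter_upwards [hbv.ae_differentiableWithinAt_of_mem] with r hr hmem
  exact (hr hmem).differentiableAt (isOpen_Ioo.mem_nhds hmem)

theorem eventually_mem_right : ∀ᶠ r in 𝓝[>] (0 : ℝ), r ∈ Ioo (0 : ℝ) 1 :=
  Ioo_mem_nhdsGT one_pos

theorem eventually_mem_left : ∀ᶠ r in 𝓝[<] (1 : ℝ), r ∈ Ioo (0 : ℝ) 1 :=
  Ioo_mem_nhdsLT one_pos

theorem measurable_radialLaplacian {m : ℤ} {u : ℝ → ℂ} (h : MemH2 m u) :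
    AEStronglyMeasurable (radialLaplacian m u) (volume.restrict (Ioo 0 1)) := by
  have hu : AEStronglyMeasurable u (volume.restrict (Ioo (0 : ℝ) 1)) :=
    h.differentiableOn.continuousOn.aestronglyMeasurable measurableSet_Ioo
  have h1 : Measurable (deriv u) := measurable_deriv u
  have h2 : Measurable (deriv (deriv u)) := measurable_deriv _
  have hr : Measurable (fun r : ℝ => (r : ℂ)) := Complex.measurable_ofReal
  exact (h2.add (h1.div hr)).aestronglyMeasurable.sub
    (((measurable_const.div (hr.pow_const 2)).aestronglyMeasurable).mul hu)

theorem deriv_add_on {m : ℤ} {u v : ℝ → ℂ} (hu : MemH2 m u) (hv : MemH2 m v) :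
    EqOn (deriv (u + v)) (deriv u + deriv v) (Ioo 0 1) := fun _ hr =>
  deriv_add (hu.differentiableAt hr) (hv.differentiableAt hr)

theorem deriv_smul_on {m : ℤ} {u : ℝ → ℂ} (c : ℂ) (hu : MemH2 m u) :
    EqOn (deriv (c • u)) (c • deriv u) (Ioo 0 1) := fun _ hr =>
  deriv_const_smul c (hu.differentiableAt hr)

theorem ac_congr {f g : ℝ → ℂ} {a b : ℝ} (hfg : EqOn f g (uIcc a b))
    (hf : AbsolutelyContinuousOnInterval f a b) : AbsolutelyContinuousOnInterval g a b := by
  rw [absolutelyContinuousOnInterval_iff] at hf ⊢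
  intro ε hε
  obtain ⟨δ, hδ, H⟩ := hf ε hε
  refine ⟨δ, hδ, fun E hE hlt => ?_⟩
  convert H E hE hlt using 2
  rename_i i hi
  have := hE.1 i hi
  rw [hfg this.1, hfg this.2]

theorem radialLaplacian_add {m : ℤ} {u v : ℝ → ℂ} (hu : MemH2 m u) (hv : MemH2 m v) :
    ∀ᵐ r, r ∈ Ioo (0 : ℝ) 1 →
      radialLaplacian m (u + v) r = radialLaplacian m u r + radialLaplacian m v r := by
  filter_upwards [hu.ae_differentiableAt_deriv, hv.ae_differentiableAt_deriv] with r h1 h2 hr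
  have e : deriv (u + v) =ᶠ[𝓝 r] deriv u + deriv v :=
    (deriv_add_on hu hv).eventuallyEq_of_mem (isOpen_Ioo.mem_nhds hr)
  have e2 : deriv (deriv (u + v)) r = deriv (deriv u) r + deriv (deriv v) r := by
    rw [e.deriv_eq, deriv_add (h1 hr) (h2 hr)]
  simp only [radialLaplacian, e2, e.eq_of_nhds, Pi.add_apply]
  ring

theorem radialLaplacian_smul {m : ℤ} {u : ℝ → ℂ} (c : ℂ) (hu : MemH2 m u) :
    ∀ᵐ r, r ∈ Ioo (0 : ℝ) 1 →
      radialLaplacian m (c • u) r = c * radialLaplacian m u r := by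
  filter_upwards [hu.ae_differentiableAt_deriv] with r h1 hr
  have e : deriv (c • u) =ᶠ[𝓝 r] c • deriv u :=
    (deriv_smul_on c hu).eventuallyEq_of_mem (isOpen_Ioo.mem_nhds hr)
  have e2 : deriv (deriv (c • u)) r = c * deriv (deriv u) r := by
    rw [e.deriv_eq, deriv_const_smul c (h1 hr), smul_eq_mul]
  simp only [radialLaplacian, e2, e.eq_of_nhds, Pi.smul_apply, smul_eq_mul]
  ring

theorem MemH2.zero (m : ℤ) : MemH2 m 0 where
  eq_zero_outside := fun _ _ => rfl
  differentiableOn := differentiableOn_const 0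
  locally_ac_deriv := fun a b _ _ _ => by
    rw [absolutelyContinuousOnInterval_iff]
    exact fun ε hε => ⟨1, one_pos, fun E _ _ => by simpa using hε⟩
  finite_energy := by simp [radialLaplacian]
  pole_value := by simp
  pole_deriv := by simp
  boundary_value := tendsto_const_nhds
  boundary_deriv := by
    rw [deriv_zero]
    exact tendsto_const_nhds

theorem MemH2.add {m : ℤ} {u v : ℝ → ℂ} (hu : MemH2 m u) (hv : MemH2 m v) : MemH2 m (u + v) where
  eq_zero_outside := fun r hr => by simp [hu.eq_zero_outside r hr, hv.eq_zero_outside r hr]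
  differentiableOn := hu.differentiableOn.add hv.differentiableOn
  locally_ac_deriv := fun a b ha hab hb => by
    refine ac_congr (fun r hr => ?_)
      ((hu.locally_ac_deriv a b ha hab hb).add (hv.locally_ac_deriv a b ha hab hb))
    rw [uIcc_of_le hab.le] at hr
    exact (deriv_add_on hu hv ⟨ha.trans_le hr.1, hr.2.trans_lt hb⟩).symm
  finite_energy := by
    have hm : AEStronglyMeasurable
        (fun r => ‖radialLaplacian m u r + radialLaplacian m v r‖ ^ 2 * r)
        (volume.restrict (Ioo 0 1)) :=
      (((measurable_radialLaplacian hu).add (measurable_radialLaplacian hv)).norm.pow 2).mul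
        measurable_id.aestronglyMeasurable
    have hI : IntegrableOn (fun r => ‖radialLaplacian m u r + radialLaplacian m v r‖ ^ 2 * r)
        (Ioo 0 1) := by
      refine Integrable.mono' ((hu.finite_energy.add hv.finite_energy).const_mul 2) hm ?_
      filter_upwards [ae_restrict_mem measurableSet_Ioo] with r hr
      rw [Real.norm_of_nonneg (mul_nonneg (by positivity) hr.1.le)]
      simp only [Pi.add_apply]
      rw [← add_mul, ← mul_assoc]
      refine mul_le_mul_of_nonneg_right ?_ hr.1.le
      have h1 := norm_add_le (radialLaplacian m u r) (radialLaplacian m v r)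
      have h2 := norm_nonneg (radialLaplacian m u r + radialLaplacian m v r)
      nlinarith [sq_nonneg (‖radialLaplacian m u r‖ - ‖radialLaplacian m v r‖)]
    refine hI.congr ?_
    rw [EventuallyEq, ae_restrict_iff' measurableSet_Ioo]
    filter_upwards [radialLaplacian_add hu hv] with r h hr
    rw [h hr]
  pole_value := by simpa [mul_add] using hu.pole_value.add hv.pole_value
  pole_deriv := by
    have := hu.pole_deriv.add hv.pole_deriv
    rw [add_zero] at this
    refine this.congr' ?_
    filter_upwards [eventually_mem_right] with r hr
    rw [deriv_add_on hu hv hr, Pi.add_apply, mul_add]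
  boundary_value := by
    have := hu.boundary_value.add hv.boundary_value
    rw [add_zero] at this
    exact this
  boundary_deriv := by
    have := hu.boundary_deriv.add hv.boundary_deriv
    rw [add_zero] at this
    refine this.congr' ?_
    filter_upwards [eventually_mem_left] with r hr
    rw [deriv_add_on hu hv hr, Pi.add_apply]

theorem MemH2.smul {m : ℤ} {u : ℝ → ℂ} (c : ℂ) (hu : MemH2 m u) : MemH2 m (c • u) where
  eq_zero_outside := fun r hr => by simp [hu.eq_zero_outside r hr]
  differentiableOn := hu.differentiableOn.const_smul c
  locally_ac_deriv := fun a b ha hab hb => by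
    refine ac_congr (fun r hr => ?_) ((hu.locally_ac_deriv a b ha hab hb).const_smul c)
    rw [uIcc_of_le hab.le] at hr
    exact (deriv_smul_on c hu ⟨ha.trans_le hr.1, hr.2.trans_lt hb⟩).symm
  finite_energy := by
    refine Integrable.congr (hu.finite_energy.const_mul (‖c‖ ^ 2)) ?_
    rw [EventuallyEq, ae_restrict_iff' measurableSet_Ioo]
    filter_upwards [radialLaplacian_smul c hu] with r h hr
    rw [h hr, norm_mul]
    ring
  pole_value := by
    have := hu.pole_value.const_mul c
    rw [mul_zero] at this
    exact this.congr fun r => by simp only [Pi.smul_apply, smul_eq_mul]; ring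
  pole_deriv := by
    have := hu.pole_deriv.const_mul c
    rw [mul_zero] at this
    refine this.congr' ?_
    filter_upwards [eventually_mem_right] with r hr
    rw [deriv_smul_on c hu hr, Pi.smul_apply, smul_eq_mul]
    ring
  boundary_value := by
    have := hu.boundary_value.const_smul c
    rw [smul_zero] at this
    exact this
  boundary_deriv := by
    have := hu.boundary_deriv.const_smul c
    rw [smul_zero] at this
    refine this.congr' ?_
    filter_upwards [eventually_mem_left] with r hr
    rw [deriv_smul_on c hu hr, Pi.smul_apply]

/-- The space `H̊²ₘ(I)`. -/
def H2 (m : ℤ) : Submodule ℂ (ℝ → ℂ) where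
  carrier := {u | MemH2 m u}
  zero_mem' := MemH2.zero m
  add_mem' := MemH2.add
  smul_mem' := fun c _ h => MemH2.smul c h

/-- Restriction of a polynomial to `I` (extended by zero outside `I`). -/
def polyOnI : Polynomial ℂ →ₗ[ℂ] (ℝ → ℂ) where
  toFun p := (Ioo (0 : ℝ) 1).indicator fun r => p.eval (r : ℂ)
  map_add' p q := by
    ext r
    by_cases h : r ∈ Ioo (0 : ℝ) 1 <;> simp [Set.indicator, h]
  map_smul' c p := by
    ext r
    by_cases h : r ∈ Ioo (0 : ℝ) 1 <;> simp [Set.indicator, h]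

/-- The Galerkin space `X_N^m = ℙ_N(I) ∩ H̊²ₘ(I)`. -/
def galerkinSpace (m : ℤ) (N : ℕ) : Submodule ℂ (ℝ → ℂ) :=
  (Polynomial.degreeLE ℂ N).map polyOnI ⊓ H2 m

/-- `(lam, ψ) ∈ ℝ × V` solves the eigenvalue problem on `V`: `ℬₘ(ψ,ψ) = 1` and
`𝒜ₘ(ψ,v) = lam ℬₘ(ψ,v)` for all `v ∈ V`. The continuous problem is `V = H2 m`, the Galerkin scheme
is `V = galerkinSpace m N`. -/
def IsEigenpair (m : ℤ) (V : Submodule ℂ (ℝ → ℂ)) (lam : ℝ) (ψ : ℝ → ℂ) : Prop :=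
  ψ ∈ V ∧ formB m ψ ψ = 1 ∧ ∀ v ∈ V, formA m ψ v = (lam : ℂ) * formB m ψ v

/-- The `l`-th eigenvalue (`l = 1, 2, …`) of the problem on `V`, in ascending order and counted with
multiplicity: the least `μ` such that the eigenfunctions with eigenvalues at most `μ` span a space
of dimension at least `l`. -/
def eigenvalue (m : ℤ) (V : Submodule ℂ (ℝ → ℂ)) (l : ℕ) : ℝ :=
  sInf {μ : ℝ | (l : Cardinal) ≤
    Module.rank ℂ (Submodule.span ℂ {ψ : ℝ → ℂ | ∃ ν ≤ μ, IsEigenpair m V ν ψ})}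

/-- `ψ 0, …, ψ (l-1)` are linearly independent normalized eigenfunctions of the continuous problem
for its first `l` eigenvalues. -/
def AreFirstEigenfunctions (m : ℤ) (l : ℕ) (ψ : Fin l → ℝ → ℂ) : Prop :=
  LinearIndependent ℂ ψ ∧ ∀ i : Fin l, IsEigenpair m (H2 m) (eigenvalue m (H2 m) (i + 1)) (ψ i)

open Classical in
/-- The `𝒜ₘ`-orthogonal projection `Π_N^{2,m} : H̊²ₘ(I) → X_N^m`: the element `w` of `X_N^m` with
`𝒜ₘ(u - w, v) = 0` for all `v ∈ X_N^m`. -/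
def galerkinProj (m : ℤ) (N : ℕ) (u : ℝ → ℂ) : ℝ → ℂ :=
  if h : ∃ w ∈ galerkinSpace m N, ∀ v ∈ galerkinSpace m N, formA m (u - w) v = 0 then h.choose
  else 0

/-- The quotient `ℬₘ(v,v) / ℬₘ(Π v, Π v)` in `[0,∞]`; it is `∞` if `ℬₘ(v,v) > 0` and `Π v = 0`. -/
def projRatio (m : ℤ) (N : ℕ) (v : ℝ → ℂ) : ℝ≥0∞ :=
  ENNReal.ofReal (formB m v v).re /
    ENNReal.ofReal (formB m (galerkinProj m N v) (galerkinProj m N v)).re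

end StokesDisk

end

/-! The map `energyMap`, $u\mapsto\sqrt r\,(u''+u'/r-m^2u/r^2)$, turns $\mathcal A_m$ into the inner
product of $L^2(0,1)$, and `gradMap`, $u\mapsto(\sqrt r\,u',|m|u/\sqrt r)$, does the same for
$\mathcal B_m$ in $L^2\times L^2$. Two analytic facts make the eigenvalue problem one of compact
operators. The energy image of $H_m$ is closed (`isClosed_map_energyMap`): it is the orthogonal
complement of the single function $r^{|m|}\sqrt r$. And `gradMap` is Hilbert–Schmidt relative to the
energy (`sum_norm_sq_gradMap_le`): the values of $\sqrt r\,u'$ and $|m|u/\sqrt r$ at each point are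
bounded by the energy norm, so Bessel's inequality holds pointwise and can be integrated.

Both facts rest on the factorization, with $k=|m|$,
$r^{k+1}(u''+u'/r-k^2u/r^2)=\big(r^{2k+1}(r^{-k}u)'\big)'$. The pole conditions remove the constant
of integration, leaving a first-order equation driven by `moment`.

Compactness gives a spectral gap above every real number (`exists_gap`), hence the min-max principle
`mem_spectralSet_of_le`: a trial space on which $\mathcal A_m\le\mu\mathcal B_m$ forces at least as
many eigenvalues $\le\mu$ as its dimension. Discrete eigenfunctions used as trial functions in $H_m$
give $\lambda_m^l\le\lambda_{mN}^l$. For the upper bound the trial space is $\Pi E_{1,l}$, where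
$\mathcal A_m(\Pi v,\Pi v)\le\mathcal A_m(v,v)\le\lambda_m^l\mathcal
B_m(v,v)\le\lambda_m^lM\,\mathcal B_m(\Pi v,\Pi v)$. If $\Pi$ is not injective on $E_{1,l}$, then
$M=\infty$ and nothing is to be shown. -/

noncomputable section

namespace StokesDisk

/-! ### Compact operators between Hilbert spaces and spectral gaps. -/

section Abstract

variable {E F : Type*} [NormedAddCommGroup E] [InnerProductSpace ℂ E]
  [NormedAddCommGroup F] [InnerProductSpace ℂ F]

theorem orthonormal_snoc {n : ℕ} {e : Fin n → E} (he : Orthonormal ℂ e) {x : E} (hx : ‖x‖ = 1)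
    (hxe : ∀ i, inner ℂ (e i) x = 0) :
    Orthonormal ℂ (Fin.snoc e x : Fin (n + 1) → E) := by
  refine ⟨fun i => ?_, fun i j hij => ?_⟩
  · induction i using Fin.lastCases with
    | last => simpa using hx
    | cast i => simpa using he.1 i
  · induction i using Fin.lastCases with
    | last =>
      induction j using Fin.lastCases with
      | last => exact absurd rfl hij
      | cast j => simpa using inner_eq_zero_symm.1 (hxe j)
    | cast i =>
      induction j using Fin.lastCases with
      | last => simpa using hxe i
      | cast j => simpa using he.2 (fun h => hij (by rw [h]))

/-- A bounded operator whose Hilbert–Schmidt sums are bounded is compact. -/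
theorem isCompactOperator_of_sum_le [CompleteSpace F] (S : E →L[ℂ] F) (D : ℝ)
    (hD : ∀ (n : ℕ) (e : Fin n → E), Orthonormal ℂ e → ∑ i, ‖S (e i)‖ ^ 2 ≤ D) :
    IsCompactOperator S := by
  set Q : Set ℝ := {t | ∃ (n : ℕ) (e : Fin n → E), Orthonormal ℂ e ∧ ∑ i, ‖S (e i)‖ ^ 2 = t}
  have hQ : BddAbove Q := ⟨D, by rintro _ ⟨n, e, he, rfl⟩; exact hD n e he⟩
  have hQ0 : Q.Nonempty := ⟨0, 0, Fin.elim0, ⟨fun i => i.elim0, fun i => i.elim0⟩, by simp⟩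
  suffices h : S ∈ closure {f : E →L[ℂ] F | IsCompactOperator f} by
    rwa [isClosed_setOfPred_isCompactOperator.closure_eq] at h
  rw [Metric.mem_closure_iff]
  intro ε hε
  -- A nearly maximal orthonormal family: a further unit vector orthogonal to it can contribute at
  -- most $(\varepsilon/2)^2$, so $S$ is small off its span and is approximated by the finite-rank
  -- operator $S P_U$.
  obtain ⟨_, ⟨n, e, he, rfl⟩, hlt⟩ := exists_lt_of_lt_csSup hQ0
    (show sSup Q - (ε / 2) ^ 2 < sSup Q by have := pow_pos (half_pos hε) 2; linarith)
  have hunit : ∀ x : E, ‖x‖ = 1 → (∀ i, inner ℂ (e i) x = 0) → ‖S x‖ ≤ ε / 2 := by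
    intro x hx hxe
    have := le_csSup hQ ⟨n + 1, _, orthonormal_snoc he hx hxe, rfl⟩
    rw [Fin.sum_univ_castSucc] at this
    simp only [Fin.snoc_castSucc, Fin.snoc_last] at this
    exact le_of_sq_le_sq (by linarith) (by positivity)
  have hperp : ∀ x : E, (∀ i, inner ℂ (e i) x = 0) → ‖S x‖ ≤ ε / 2 * ‖x‖ := by
    intro x hxe
    rcases eq_or_ne x 0 with rfl | hx
    · simp
    have hx' : (‖x‖ : ℂ) ≠ 0 := by simpa using hx
    have := hunit ((‖x‖ : ℂ)⁻¹ • x) (norm_smul_inv_norm hx)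
      (fun i => by rw [inner_smul_right, hxe i, mul_zero])
    rw [map_smul, norm_smul, norm_inv, Complex.norm_real, norm_norm,
      inv_mul_le_iff₀ (norm_pos_iff.2 hx)] at this
    linarith
  let U : Submodule ℂ E := Submodule.span ℂ (Set.range e)
  have : FiniteDimensional ℂ U := FiniteDimensional.span_of_finite ℂ (Set.finite_range e)
  refine ⟨S ∘L U.subtypeL ∘L U.orthogonalProjectionOnto, ?_, ?_⟩
  · exact (isCompactOperator_of_locallyCompactSpace_rng (S ∘L U.subtypeL)).comp_clm
      U.orthogonalProjectionOnto
  · rw [dist_eq_norm]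
    refine (ContinuousLinearMap.opNorm_le_bound _ (half_pos hε).le fun x => ?_).trans_lt
      (half_lt_self hε)
    have h1 : (S - S ∘L U.subtypeL ∘L U.orthogonalProjectionOnto) x
        = S (x - U.starProjection x) := (map_sub S _ _).symm
    rw [h1]
    refine (hperp _ fun i => ?_).trans ?_
    · exact Submodule.mem_orthogonal _ _ |>.1 (U.sub_starProjection_mem_orthogonal x) _
        (Submodule.subset_span ⟨i, rfl⟩)
    · gcongr
      have h3 : x - U.starProjection x = Uᗮ.starProjection x := by
        rw [Submodule.starProjection_orthogonal_val]
      rw [h3]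
      exact Uᗮ.norm_starProjection_apply_le x

/-- The norm of a nonzero compact positive operator is an eigenvalue. -/
theorem hasEigenvalue_norm [CompleteSpace E] [Nontrivial E] {T : E →L[ℂ] E}
    (hT : IsCompactOperator T) (hs : (T : E →ₗ[ℂ] E).IsSymmetric)
    (hpos : ∀ x, 0 ≤ (inner ℂ (T x) x).re) (h0 : T ≠ 0) :
    Module.End.HasEigenvalue (T : E →ₗ[ℂ] E) ((‖T‖ : ℝ) : ℂ) := by
  have hn : ((‖T‖ : ℝ) : ℂ) ≠ 0 := by simpa using h0
  rw [hT.hasEigenvalue_iff_mem_spectrum hn]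
  by_contra hmem
  -- Off the spectrum the Rayleigh quotient stays below $\|T\|-\varepsilon$, while for symmetric $T$
  -- the norm is the supremum of its absolute value; positivity removes the absolute value.
  obtain ⟨ε, hε, h⟩ := T.rayleighQuotient_le_of_norm_mem_resolventSet
    (by simpa [spectrum, resolventSet] using hmem)
  have h1 : ‖T‖ ≤ ‖T‖ - ε := by
    conv_lhs => rw [T.norm_eq_iSup_rayleighQuotient hs]
    refine ciSup_le fun x => ?_
    rw [abs_of_nonneg]
    · exact h x
    · exact div_nonneg (hpos x) (by positivity)
  linarith

/-- Spectral gap of the form `⟪S x, S y⟫` relative to the inner product: on the orthogonal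
complement of the eigenvectors with eigenvalue at most `lam`, the quotient `‖v‖² / ‖S v‖²` is
bounded below by some `ν > lam`. -/
theorem exists_gap_of_isCompactOperator [CompleteSpace E] [CompleteSpace F] (S : E →L[ℂ] F)
    (hS : IsCompactOperator S) (lam : ℝ) :
    ∃ ν > lam, ∀ v : E,
      (∀ x : E, ∀ ν' ≤ lam, (∀ y, inner ℂ y x = (ν' : ℂ) * inner ℂ (S y) (S x)) →
        inner ℂ x v = 0) → ν * ‖S v‖ ^ 2 ≤ ‖v‖ ^ 2 := by
  let T : E →L[ℂ] E := ContinuousLinearMap.adjoint S ∘L S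
  have hTi : ∀ x y, inner ℂ (T x) y = inner ℂ (S x) (S y) := fun x y => by
    simp [T, ContinuousLinearMap.adjoint_inner_left]
  have hTi' : ∀ x y, inner ℂ x (T y) = inner ℂ (S x) (S y) := fun x y => by
    simp [T, ContinuousLinearMap.adjoint_inner_right]
  have hT : IsCompactOperator T := hS.clm_comp (ContinuousLinearMap.adjoint S)
  have hTs : (T : E →ₗ[ℂ] E).IsSymmetric := fun x y => by
    change inner ℂ (T x) y = inner ℂ x (T y)
    rw [hTi, hTi']
  -- With $T=S^*S$ the weak eigenvalue equation reads $x=\nu' Tx$, so the eigenvalues of the problem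
  -- are reciprocals of those of $T$. The complement $W$ of these eigenvectors is $T$-invariant.
  let Z : Set E := {x | ∃ ν' ≤ lam, x = (ν' : ℂ) • T x}
  let W : Submodule ℂ E := (Submodule.span ℂ Z)ᗮ
  have hWmem : ∀ v, v ∈ W ↔ ∀ x ∈ Z, inner ℂ x v = 0 := by
    intro v
    constructor
    · exact fun h x hx => (Submodule.mem_orthogonal _ _).1 h x (Submodule.subset_span hx)
    · intro h
      rw [Submodule.mem_orthogonal]
      intro u hu
      induction hu using Submodule.span_induction with
      | mem x hx => exact h x hx
      | zero => simp
      | add x y _ _ hx hy => rw [inner_add_left, hx, hy, add_zero]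
      | smul a x _ hx => rw [inner_smul_left, hx, mul_zero]
  have hWinv : ∀ v ∈ W, (T : E →ₗ[ℂ] E) v ∈ W := by
    intro v hv
    rw [hWmem] at hv ⊢
    intro x hx
    have h2 := hv x hx
    obtain ⟨ν', hν', hx'⟩ := id hx
    change inner ℂ x (T v) = 0
    rw [hTi', ← hTi]
    rcases eq_or_ne (ν' : ℂ) 0 with h0 | h0
    · rw [h0, zero_smul] at hx'
      simp [hx']
    · have : T x = (ν' : ℂ)⁻¹ • x := by
        conv_rhs => rw [hx']
        rw [smul_smul, inv_mul_cancel₀ h0, one_smul]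
      rw [this, inner_smul_left, h2, mul_zero]
  let R : W →L[ℂ] W := T.restrict hWinv
  have hRi : ∀ x y : W, inner ℂ (R x) y = inner ℂ (S x) (S y) := fun x y => hTi x y
  have hR : IsCompactOperator R := hT.restrict' hWinv
  have hRs : (R : W →ₗ[ℂ] W).IsSymmetric := hTs.restrict_invariant hWinv
  have hRp : ∀ x, 0 ≤ (inner ℂ (R x) x).re := fun x => by
    rw [hRi]
    exact inner_self_nonneg (𝕜 := ℂ)
  have hbound : ∀ x : W, ‖S x‖ ^ 2 ≤ ‖R‖ * ‖(x : E)‖ ^ 2 := by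
    intro x
    have h1 : ‖S x‖ ^ 2 = ‖inner ℂ (R x) x‖ := by
      rw [hRi, inner_self_eq_norm_sq_to_K]
      simp
    rw [h1]
    refine (norm_inner_le_norm _ _).trans ?_
    calc ‖R x‖ * ‖x‖ ≤ ‖R‖ * ‖x‖ * ‖x‖ := by gcongr; exact R.le_opNorm x
      _ = ‖R‖ * ‖(x : E)‖ ^ 2 := by rw [Submodule.coe_norm]; ring
  have hWv : ∀ v : E, (∀ x : E, ∀ ν' ≤ lam,
      (∀ y, inner ℂ y x = (ν' : ℂ) * inner ℂ (S y) (S x)) → inner ℂ x v = 0) → v ∈ W := by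
    intro v hv
    rw [hWmem]
    rintro x ⟨ν', hν', hx⟩
    refine hv x ν' hν' fun y => ?_
    conv_lhs => rw [hx]
    rw [inner_smul_right, hTi']
  -- If $T$ vanishes on $W$, so does $S$, and any $\nu>$ `lam` will do.
  by_cases hR0 : R = 0
  · refine ⟨lam + 1, by linarith, fun v hv => ?_⟩
    have := hbound ⟨v, hWv v hv⟩
    rw [hR0, ContinuousLinearMap.opNorm_zero, zero_mul] at this
    have h0 : ‖S v‖ ^ 2 = 0 := le_antisymm this (by positivity)
    rw [h0, mul_zero]
    positivity
  have hRn : 0 < ‖R‖ := (ContinuousLinearMap.opNorm_nonneg R).lt_of_ne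
    fun h => hR0 ((ContinuousLinearMap.opNorm_zero_iff R).1 h.symm)
  -- The norm of $R$ is an eigenvalue of $R$. Were $\|R\|^{-1}\le$ `lam`, its eigenvector would lie
  -- both in $Z$ and in $W=Z^\perp$, hence vanish.
  refine ⟨‖R‖⁻¹, ?_, fun v hv => ?_⟩
  · have : Nontrivial W := by
      by_contra h
      rw [not_nontrivial_iff_subsingleton] at h
      exact hR0 (Subsingleton.elim _ _)
    obtain ⟨x, hx⟩ := (hasEigenvalue_norm hR hRs hRp hR0).exists_hasEigenvector
    have hx1 : R x = ((‖R‖ : ℝ) : ℂ) • x := hx.apply_eq_smul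
    have hx2 : T x = ((‖R‖ : ℝ) : ℂ) • (x : E) := congrArg Subtype.val hx1
    by_contra hle
    have hxZ : (x : E) ∈ Z := by
      refine ⟨‖R‖⁻¹, not_lt.1 hle, ?_⟩
      rw [hx2, smul_smul, Complex.ofReal_inv, inv_mul_cancel₀ (by exact_mod_cast hRn.ne'), one_smul]
    have := (hWmem _).1 x.2 _ hxZ
    exact hx.2 (Subtype.ext (inner_self_eq_zero.1 this))
  · have := hbound ⟨v, hWv v hv⟩
    rw [inv_mul_le_iff₀ hRn]
    exact this

end Abstract

/-! ### Absolute continuity of complex-valued functions and primitives. -/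

section AbsoluteContinuity

theorem ac_const (c : ℂ) (a b : ℝ) : AbsolutelyContinuousOnInterval (fun _ : ℝ => c) a b :=
  (LipschitzWith.const c).lipschitzOnWith.absolutelyContinuousOnInterval

theorem ac_intervalIntegral {f : ℝ → ℂ} {a b c : ℝ} (hf : IntervalIntegrable f volume a b)
    (hc : c ∈ uIcc a b) : AbsolutelyContinuousOnInterval (fun x => ∫ t in c..x, f t) a b := by
  have hre : IntervalIntegrable (fun t => (f t).re) volume a b := ⟨hf.1.re, hf.2.re⟩
  have him : IntervalIntegrable (fun t => (f t).im) volume a b := ⟨hf.1.im, hf.2.im⟩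
  -- Real and imaginary parts are treated as real primitives and recombined with the constants $1$
  -- and $i$.
  have h := ((hre.absolutelyContinuousOnInterval_intervalIntegral hc).smul (ac_const 1 a b)).add
    ((him.absolutelyContinuousOnInterval_intervalIntegral hc).smul (ac_const Complex.I a b))
  refine ac_congr (fun x hx => ?_) h
  have hs : uIcc c x ⊆ uIcc a b := uIcc_subset_uIcc hc hx
  have e1 : IntervalIntegrable (fun t => (((f t).re : ℝ) : ℂ)) volume c x :=
    ⟨(hre.mono_set hs).1.ofReal, (hre.mono_set hs).2.ofReal⟩
  have e2 : IntervalIntegrable (fun t => (((f t).im : ℝ) : ℂ) * Complex.I) volume c x :=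
    (IntervalIntegrable.mul_const (f := fun t => (((f t).im : ℝ) : ℂ))
      ⟨(him.mono_set hs).1.ofReal, (him.mono_set hs).2.ofReal⟩ Complex.I)
  have e3 : ∫ t in c..x, f t = ∫ t in c..x, ((((f t).re : ℝ) : ℂ) + ((f t).im : ℂ) * Complex.I) := by
    simp only [Complex.re_add_im]
  simp only [Pi.add_apply, Pi.smul_apply', Complex.real_smul, mul_one]
  rw [e3, intervalIntegral.integral_add e1 e2, intervalIntegral.integral_mul_const,
    intervalIntegral.integral_ofReal, intervalIntegral.integral_ofReal]

theorem ac_of_continuousOn_deriv {u : ℝ → ℂ} {a b : ℝ} (hu : ∀ r ∈ uIcc a b, DifferentiableAt ℝ u r)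
    (hu' : ContinuousOn (deriv u) (uIcc a b)) : AbsolutelyContinuousOnInterval u a b := by
  obtain ⟨C, hC⟩ := isCompact_uIcc.exists_bound_of_continuousOn hu'
  have h : LipschitzOnWith C.toNNReal u (uIcc a b) :=
    (convex_uIcc a b).lipschitzOnWith_of_nnnorm_deriv_le hu fun x hx =>
      NNReal.le_toNNReal_of_coe_le (hC x hx)
  exact h.absolutelyContinuousOnInterval

theorem ac_pow (n : ℕ) (a b : ℝ) : AbsolutelyContinuousOnInterval (fun r : ℝ => (r : ℂ) ^ n) a b :=
  ContDiffOn.absolutelyContinuousOnInterval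
    (Complex.ofRealCLM.contDiff.pow n).contDiffOn

theorem hasDerivAt_ofReal_pow (n : ℕ) (r : ℝ) :
    HasDerivAt (fun r : ℝ => (r : ℂ) ^ n) (n * (r : ℂ) ^ (n - 1)) r := by
  simpa using ((hasDerivAt_id r).ofReal_comp).fun_pow n

/-- A locally absolutely continuous function on `(0,1)` with integrable derivative is, up to a
constant, the primitive of its derivative. -/
theorem exists_eq_const_add_integral {Q q : ℝ → ℂ}
    (hQ : ∀ a b : ℝ, 0 < a → a < b → b < 1 → AbsolutelyContinuousOnInterval Q a b)
    (hq : IntervalIntegrable q volume 0 1)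
    (hd : ∀ᵐ r, r ∈ Ioo (0 : ℝ) 1 → HasDerivAt Q (q r) r) :
    ∃ c, ∀ r ∈ Ioo (0 : ℝ) 1, Q r = c + ∫ t in (0 : ℝ)..r, q t := by
  -- The difference of $Q$ and the primitive is absolutely continuous with derivative zero almost
  -- everywhere, hence constant on compact subintervals; the constant is then read off at $1/2$.
  have key : ∀ a b : ℝ, 0 < a → a < b → b < 1 →
      Q a - ∫ t in (0 : ℝ)..a, q t = Q b - ∫ t in (0 : ℝ)..b, q t := by
    intro a b ha hab hb
    have hsub : uIcc a b ⊆ uIcc 0 1 := by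
      rw [uIcc_of_le hab.le, uIcc_of_le zero_le_one]
      exact Icc_subset_Icc ha.le hb.le
    have hac : AbsolutelyContinuousOnInterval (fun r => Q r - ∫ t in (0 : ℝ)..r, q t) a b :=
      (hQ a b ha hab hb).sub ((ac_intervalIntegral hq (by simp)).mono hsub)
    have h0 : ∀ᵐ x, x ∈ uIcc a b → HasDerivAt (fun r => Q r - ∫ t in (0 : ℝ)..r, q t) 0 x := by
      filter_upwards [hd, hq.ae_hasDerivAt_integral] with x h1 h2 hx
      have hx' := hx
      rw [uIcc_of_le hab.le] at hx'
      simpa using (h1 ⟨ha.trans_le hx'.1, hx'.2.trans_lt hb⟩).fun_sub (h2 (hsub hx) 0 (by simp))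
    obtain ⟨C, hC⟩ := hac.const_of_ae_hasDerivAt_zero h0
    exact (hC a (by simp)).trans (hC b (by simp)).symm
  refine ⟨Q (1 / 2) - ∫ t in (0 : ℝ)..(1 / 2), q t, fun r hr => ?_⟩
  rcases lt_trichotomy r (1 / 2) with h | h | h
  · rw [← key r (1 / 2) hr.1 h (by norm_num)]; ring
  · subst h; ring
  · rw [key (1 / 2) r (by norm_num) h hr.2]; ring

end AbsoluteContinuity

/-! ### Weighted primitives of square-integrable functions. -/

section Moment

/-- The primitive `∫₀ʳ sᵏ √s h(s) ds`. -/
def moment (k : ℕ) (h : ℝ → ℂ) (r : ℝ) : ℂ :=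
  ∫ s in (0 : ℝ)..r, ((s ^ k * √s : ℝ) : ℂ) * h s

/-- The square root of the energy of `h` on `(0,r)`. -/
def tailNorm (h : ℝ → ℂ) (r : ℝ) : ℝ := √(∫ s in (0 : ℝ)..r, ‖h s‖ ^ 2)

variable {h : ℝ → ℂ}

theorem intervalIntegrable_of_memLp (hh : MemLp h 2 (volume.restrict (Ioo 0 1))) :
    IntervalIntegrable h volume 0 1 := by
  rw [intervalIntegrable_iff_integrableOn_Ioo_of_le zero_le_one]
  exact hh.integrable one_le_two

theorem intervalIntegrable_sq_of_memLp (hh : MemLp h 2 (volume.restrict (Ioo 0 1))) :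
    IntervalIntegrable (fun s => ‖h s‖ ^ 2) volume 0 1 := by
  rw [intervalIntegrable_iff_integrableOn_Ioo_of_le zero_le_one]
  exact hh.integrable_norm_pow two_ne_zero

theorem intervalIntegrable_moment (k : ℕ) (hh : MemLp h 2 (volume.restrict (Ioo 0 1))) :
    IntervalIntegrable (fun s => ((s ^ k * √s : ℝ) : ℂ) * h s) volume 0 1 :=
  (intervalIntegrable_of_memLp hh).continuousOn_mul (by fun_prop)

theorem sq_integral_norm_le (hh : MemLp h 2 (volume.restrict (Ioo 0 1))) {r : ℝ} (h0 : 0 < r)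
    (h1 : r ≤ 1) : (∫ s in (0 : ℝ)..r, ‖h s‖) ^ 2 ≤ r * ∫ s in (0 : ℝ)..r, ‖h s‖ ^ 2 := by
  have hsub : uIcc 0 r ⊆ uIcc (0 : ℝ) 1 := by
    rw [uIcc_of_le h0.le, uIcc_of_le zero_le_one]
    exact Icc_subset_Icc le_rfl h1
  have i1 := ((intervalIntegrable_of_memLp hh).mono_set hsub).norm
  have i2 := (intervalIntegrable_sq_of_memLp hh).mono_set hsub
  set M := ∫ s in (0 : ℝ)..r, ‖h s‖
  -- Cauchy–Schwarz from the variance: $M/r$ is the mean of $\|h\|$ on $(0,r)$.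
  have h2 : 0 ≤ ∫ s in (0 : ℝ)..r, (‖h s‖ - M / r) ^ 2 :=
    intervalIntegral.integral_nonneg h0.le fun _ _ => sq_nonneg _
  have h3 : ∫ s in (0 : ℝ)..r, (‖h s‖ - M / r) ^ 2
      = (∫ s in (0 : ℝ)..r, ‖h s‖ ^ 2) - 2 * (M / r) * M + r * (M / r) ^ 2 := by
    have : ∀ s, (‖h s‖ - M / r) ^ 2 = ‖h s‖ ^ 2 - 2 * (M / r) * ‖h s‖ + (M / r) ^ 2 :=
      fun s => by ring
    simp only [this]
    rw [intervalIntegral.integral_add (i2.sub (i1.const_mul _)) intervalIntegrable_const,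
      intervalIntegral.integral_sub i2 (i1.const_mul _), intervalIntegral.integral_const_mul,
      intervalIntegral.integral_const]
    simp [M]
  rw [h3] at h2
  have h4 : r * ((∫ s in (0 : ℝ)..r, ‖h s‖ ^ 2) - 2 * (M / r) * M + r * (M / r) ^ 2)
      = r * (∫ s in (0 : ℝ)..r, ‖h s‖ ^ 2) - M ^ 2 := by
    field_simp
    ring
  have h5 := mul_nonneg h0.le h2
  linarith

/-- The weight is at most $r^k\sqrt r$ on $(0,r)$, and Cauchy–Schwarz supplies another $\sqrt r$.
The energy on $(0,r)$ alone is kept in the bound, since its decay at the pole is what later makes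
$u'$ vanish there. -/
theorem norm_moment_le (k : ℕ) (hh : MemLp h 2 (volume.restrict (Ioo 0 1))) {r : ℝ} (h0 : 0 < r)
    (h1 : r ≤ 1) : ‖moment k h r‖ ≤ r ^ (k + 1) * tailNorm h r := by
  have hsub : uIcc 0 r ⊆ uIcc (0 : ℝ) 1 := by
    rw [uIcc_of_le h0.le, uIcc_of_le zero_le_one]
    exact Icc_subset_Icc le_rfl h1
  have i1 := ((intervalIntegrable_of_memLp hh).mono_set hsub).norm
  have e1 : ‖moment k h r‖ ≤ ∫ s in (0 : ℝ)..r, r ^ k * √r * ‖h s‖ := by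
    refine intervalIntegral.norm_integral_le_of_norm_le h0.le ?_ (i1.const_mul _)
    filter_upwards with s hs
    rw [norm_mul, Complex.norm_real, Real.norm_of_nonneg (by have := hs.1.le; positivity)]
    have := hs.1.le
    gcongr
    · exact hs.2
    · exact hs.2
  have e2 : ∫ s in (0 : ℝ)..r, ‖h s‖ ≤ √r * tailNorm h r := by
    rw [tailNorm, ← Real.sqrt_mul h0.le]
    exact Real.le_sqrt_of_sq_le (sq_integral_norm_le hh h0 h1)
  rw [intervalIntegral.integral_const_mul] at e1
  refine e1.trans ((mul_le_mul_of_nonneg_left e2 (by positivity)).trans_eq ?_)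
  rw [pow_succ]
  linear_combination r ^ k * tailNorm h r * Real.mul_self_sqrt h0.le

theorem tailNorm_mono (hh : MemLp h 2 (volume.restrict (Ioo 0 1))) {r : ℝ} (h0 : 0 ≤ r)
    (h1 : r ≤ 1) : tailNorm h r ≤ tailNorm h 1 := by
  refine Real.sqrt_le_sqrt (intervalIntegral.integral_mono_interval le_rfl h0 h1 ?_
    (intervalIntegrable_sq_of_memLp hh))
  exact Eventually.of_forall fun _ => sq_nonneg _

theorem tendsto_tailNorm (hh : MemLp h 2 (volume.restrict (Ioo 0 1))) :
    Tendsto (tailNorm h) (𝓝[>] 0) (𝓝 0) := by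
  have h1 := intervalIntegral.continuousOn_primitive_interval'
    (intervalIntegrable_sq_of_memLp hh) (a := 0) (by simp)
  have h2 := (h1 0 (by simp)).tendsto
  rw [intervalIntegral.integral_same, uIcc_of_le zero_le_one] at h2
  have h3 : 𝓝[>] (0 : ℝ) ≤ 𝓝[Icc 0 1] 0 :=
    nhdsWithin_le_of_mem (mem_of_superset (Ioo_mem_nhdsGT one_pos) Ioo_subset_Icc_self)
  have h4 := (h2.mono_left h3).sqrt
  rwa [Real.sqrt_zero] at h4

theorem continuousOn_moment (k : ℕ) (hh : MemLp h 2 (volume.restrict (Ioo 0 1))) :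
    ContinuousOn (moment k h) (Icc 0 1) := by
  have h1 := intervalIntegral.continuousOn_primitive_interval'
    (intervalIntegrable_moment k hh) (a := 0) (by simp)
  rwa [uIcc_of_le zero_le_one] at h1

theorem tendsto_moment_zero (k : ℕ) (hh : MemLp h 2 (volume.restrict (Ioo 0 1))) :
    Tendsto (moment k h) (𝓝[>] 0) (𝓝 0) := by
  have h2 := (continuousOn_moment k hh 0 (by simp)).tendsto
  rw [moment, intervalIntegral.integral_same] at h2
  exact h2.mono_left
    (nhdsWithin_le_of_mem (mem_of_superset (Ioo_mem_nhdsGT one_pos) Ioo_subset_Icc_self))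

theorem tendsto_moment_one (k : ℕ) (hh : MemLp h 2 (volume.restrict (Ioo 0 1))) :
    Tendsto (moment k h) (𝓝[<] 1) (𝓝 (moment k h 1)) :=
  (continuousOn_moment k hh 1 (by simp)).tendsto.mono_left
    (nhdsWithin_le_of_mem (mem_of_superset (Ioo_mem_nhdsLT one_pos) Ioo_subset_Icc_self))

end Moment

/-! ### Estimates for the first-order equation $r^{k+1}u'-kr^ku=P$. -/

section FirstOrder

variable {u P : ℝ → ℂ} {k : ℕ}

theorem hasDerivAt_div_pow {r : ℝ} (hr : 0 < r) (hu : DifferentiableAt ℝ u r)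
    (hP : (r : ℂ) ^ (k + 1) * deriv u r - k * (r : ℂ) ^ k * u r = P r) :
    HasDerivAt (fun s : ℝ => u s / (s : ℂ) ^ k) (P r / (r : ℂ) ^ (2 * k + 1)) r := by
  have hr' : (r : ℂ) ≠ 0 := by exact_mod_cast hr.ne'
  refine (hu.hasDerivAt.fun_div (hasDerivAt_ofReal_pow k r) (pow_ne_zero _ hr')).congr_deriv ?_
  rw [← hP]
  -- The case $k=0$ is separate because the exponent $k-1$ is a truncated subtraction.
  rcases k with _ | j
  · field_simp
    simp
  · simp only [Nat.add_sub_cancel]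
    field_simp
    ring

/-- Since $(u/r^k)'=P/r^{2k+1}$, any majorant of the right side integrates to a bound on the
increment. The majorant $B$ is left free because the two uses below need different powers of $s$. -/
theorem norm_div_pow_sub_le {x y : ℝ} (hx : 0 < x) (hxy : x < y) (hy : y < 1)
    (hu : ∀ r ∈ Ioo (0 : ℝ) 1, DifferentiableAt ℝ u r)
    (hP : ∀ r ∈ Ioo (0 : ℝ) 1, (r : ℂ) ^ (k + 1) * deriv u r - k * (r : ℂ) ^ k * u r = P r)
    {B B' : ℝ → ℝ} (hB0 : 0 ≤ B x) (hB : ∀ s ∈ Icc x y, HasDerivAt B (B' s) s)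
    (hPB : ∀ s ∈ Icc x y, ‖P s‖ / s ^ (2 * k + 1) ≤ B' s) :
    ‖u y / (y : ℂ) ^ k - u x / (x : ℂ) ^ k‖ ≤ B y := by
  have hmem : ∀ s ∈ Icc x y, s ∈ Ioo (0 : ℝ) 1 := fun s hs =>
    ⟨hx.trans_le hs.1, hs.2.trans_lt hy⟩
  have hd : ∀ s ∈ Icc x y, HasDerivAt (fun s : ℝ => u s / (s : ℂ) ^ k - u x / (x : ℂ) ^ k)
      (P s / (s : ℂ) ^ (2 * k + 1)) s := fun s hs =>
    (hasDerivAt_div_pow (hmem s hs).1 (hu s (hmem s hs)) (hP s (hmem s hs))).sub_const _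
  refine image_norm_le_of_norm_deriv_right_le_deriv_boundary'
    (f := fun s : ℝ => u s / (s : ℂ) ^ k - u x / (x : ℂ) ^ k) (a := x) (b := y)
    (f' := fun s => P s / (s : ℂ) ^ (2 * k + 1)) (B := B) (B' := B')
    (fun s hs => (hd s hs).continuousAt.continuousWithinAt)
    (fun s hs => (hd s (Ico_subset_Icc_self hs)).hasDerivWithinAt) (by simpa using hB0)
    (fun s hs => (hB s hs).continuousAt.continuousWithinAt)
    (fun s hs => (hB s (Ico_subset_Icc_self hs)).hasDerivWithinAt) (fun s hs => ?_)
    (right_mem_Icc.2 hxy.le)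
  have hs' := Ico_subset_Icc_self hs
  rw [norm_div, norm_pow, Complex.norm_real, Real.norm_of_nonneg (hmem s hs').1.le]
  exact hPB s hs'

/-- The pointwise bound `|u(r)| ≤ 2 N √r` when `k ≥ 1`. -/
theorem norm_le_two_mul_sqrt (hk : k ≠ 0) {N : ℝ} (hN : 0 ≤ N)
    (hu : ∀ r ∈ Ioo (0 : ℝ) 1, DifferentiableAt ℝ u r)
    (hP : ∀ r ∈ Ioo (0 : ℝ) 1, (r : ℂ) ^ (k + 1) * deriv u r - k * (r : ℂ) ^ k * u r = P r)
    (hPN : ∀ r ∈ Ioo (0 : ℝ) 1, ‖P r‖ ≤ r ^ (k + 1) * N)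
    (h1 : Tendsto u (𝓝[<] 1) (𝓝 0)) {x : ℝ} (hx : x ∈ Ioo (0 : ℝ) 1) :
    ‖u x‖ ≤ 2 * N * √x := by
  obtain ⟨j, rfl⟩ := Nat.exists_eq_succ_of_ne_zero hk
  have hx0 := hx.1
  have hsx : 0 < √x := Real.sqrt_pos.2 hx0
  have hxx : √x * √x = x := Real.mul_self_sqrt hx0.le
  have key : ∀ y ∈ Ioo x 1, ‖u y / (y : ℂ) ^ (j + 1) - u x / (x : ℂ) ^ (j + 1)‖
      ≤ 2 * N / (x ^ j * √x) := by
    intro y hy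
    -- With $k=j+1$ the derivative is at most $N/s^{j+1}\le N/(x^j\sqrt x\sqrt s)$ for $s\ge x$.
    -- Giving up part of the decay this way avoids the logarithm at $k=1$ and treats all $k\ge1$
    -- alike; then $y\to1$.
    have hBd : ∀ s ∈ Icc x y, HasDerivAt (fun s => 2 * N / (x ^ j * √x) * (√s - √x))
        (2 * N / (x ^ j * √x) * (1 / (2 * √s))) s := fun s hs =>
      ((Real.hasDerivAt_sqrt (hx0.trans_le hs.1).ne').sub_const _).const_mul _
    refine (norm_div_pow_sub_le hx0 hy.1 hy.2 hu hP (by simp) hBd fun s hs => ?_).trans ?_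
    · have hs0 : 0 < s := hx0.trans_le hs.1
      have hss : 0 < √s := Real.sqrt_pos.2 hs0
      have hsq : √s * √s = s := Real.mul_self_sqrt hs0.le
      have a1 : ‖P s‖ / s ^ (2 * (j + 1) + 1) ≤ N / (s ^ j * s) := by
        rw [div_le_div_iff₀ (by positivity) (by positivity)]
        have := mul_le_mul_of_nonneg_right (hPN s ⟨hs0, hs.2.trans_lt hy.2⟩)
          (show 0 ≤ s ^ j * s by positivity)
        refine this.trans_eq ?_
        rw [Nat.succ_eq_add_one]
        ring
      have a2 : N / (s ^ j * s) ≤ N / (x ^ j * √x * √s) := by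
        have : √x ≤ √s := Real.sqrt_le_sqrt hs.1
        have h3 : x ^ j * √x * √s ≤ s ^ j * s := by
          calc x ^ j * √x * √s ≤ s ^ j * √s * √s := by gcongr; exact hs.1
            _ = s ^ j * s := by rw [mul_assoc, hsq]
        gcongr
      refine (a1.trans a2).trans_eq ?_
      field_simp
    · have h3 : √y - √x ≤ 1 := by
        have : √y ≤ 1 := Real.sqrt_le_one.2 hy.2.le
        linarith
      have h4 : 0 ≤ 2 * N / (x ^ j * √x) := by positivity
      exact mul_le_of_le_one_right h4 h3
  have hlim : Tendsto (fun y : ℝ => ‖u y / (y : ℂ) ^ (j + 1) - u x / (x : ℂ) ^ (j + 1)‖) (𝓝[<] 1)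
      (𝓝 ‖0 / ((1 : ℝ) : ℂ) ^ (j + 1) - u x / (x : ℂ) ^ (j + 1)‖) := by
    refine ((h1.div ?_ (by simp)).sub_const _).norm
    have : Continuous fun y : ℝ => (y : ℂ) ^ (j + 1) := by fun_prop
    exact (this.tendsto 1).mono_left nhdsWithin_le_nhds
  have := le_of_tendsto hlim (by
    filter_upwards [Ioo_mem_nhdsLT hx.2] with y hy using key y hy)
  rw [zero_div, zero_sub, norm_neg, norm_div, norm_pow, Complex.norm_real,
    Real.norm_of_nonneg hx0.le, div_le_div_iff₀ (by positivity) (by positivity)] at this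
  have h5 : ‖u x‖ * (x ^ j * √x) ≤ 2 * N * √x * (x ^ j * √x) := by
    refine this.trans_eq ?_
    rw [pow_succ]
    linear_combination - 2 * N * x ^ j * hxx
  exact le_of_mul_le_mul_right h5 (by positivity)

/-- `u(r)/r → 0` at the pole when `k ≥ 2`. -/
theorem tendsto_div_zero (hk : 2 ≤ k) {N : ℝ → ℝ}
    (hu : ∀ r ∈ Ioo (0 : ℝ) 1, DifferentiableAt ℝ u r)
    (hP : ∀ r ∈ Ioo (0 : ℝ) 1, (r : ℂ) ^ (k + 1) * deriv u r - k * (r : ℂ) ^ k * u r = P r)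
    (hPN : ∀ r ∈ Ioo (0 : ℝ) 1, ‖P r‖ ≤ r ^ (k + 1) * N r)
    (hN : Tendsto N (𝓝[>] 0) (𝓝 0)) :
    Tendsto (fun r : ℝ => u r / (r : ℂ)) (𝓝[>] 0) (𝓝 0) := by
  obtain ⟨j, rfl⟩ := Nat.exists_eq_add_of_le' hk
  rw [tendsto_zero_iff_norm_tendsto_zero, Metric.tendsto_nhds]
  intro ε hε
  obtain ⟨d, hd, hdN⟩ := (mem_nhdsGT_iff_exists_Ioo_subset).1
    ((hN.eventually (gt_mem_nhds (half_pos hε))).and eventually_mem_right)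
  have hd0 : (0 : ℝ) < d := hd
  set y := d / 2 with hy
  have hyd : y ∈ Ioo 0 d := ⟨by positivity, by rw [hy]; linarith⟩
  have hy1 : y < 1 := (hdN hyd).2.2
  -- With $k=j+2$ and $\|P\|\le s^{k+1}\varepsilon/2$, the derivative of $u/s^k$ is at most
  -- $(\varepsilon/2)x^{-j}s^{-2}$ for $s\ge x$. Multiplication by $x^{j+1}$ leaves $\varepsilon/2$
  -- plus a term at the fixed point $y$ that tends to zero with $x$.
  have key : ∀ x ∈ Ioo 0 y, ‖u x / (x : ℂ)‖
      ≤ x ^ (j + 1) * ‖u y / (y : ℂ) ^ (j + 2)‖ + ε / 2 := by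
    intro x hx
    have hx0 : 0 < x := hx.1
    have hBd : ∀ s ∈ Icc x y, HasDerivAt (fun s => ε / 2 / x ^ j * (x⁻¹ - s⁻¹))
        (ε / 2 / x ^ j * (1 / s ^ 2)) s := fun s hs => by
      have := ((hasDerivAt_inv (hx0.trans_le hs.1).ne').const_sub x⁻¹).const_mul (ε / 2 / x ^ j)
      refine this.congr_deriv ?_
      ring
    have h1 := norm_div_pow_sub_le hx0 hx.2 hy1 hu hP (by simp) hBd fun s hs => by
      have hs0 : 0 < s := hx0.trans_le hs.1
      have hsd := hdN ⟨hs0, hs.2.trans_lt hyd.2⟩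
      have h2 : ‖P s‖ ≤ s ^ (j + 2 + 1) * (ε / 2) :=
        (hPN s hsd.2).trans (by gcongr; exact hsd.1.le)
      calc ‖P s‖ / s ^ (2 * (j + 2) + 1) ≤ s ^ (j + 2 + 1) * (ε / 2) / s ^ (2 * (j + 2) + 1) := by
            gcongr
        _ = ε / 2 / s ^ j * (1 / s ^ 2) := by field_simp; ring
        _ ≤ ε / 2 / x ^ j * (1 / s ^ 2) := by gcongr; exact hs.1
    have h3 : ε / 2 / x ^ j * (x⁻¹ - y⁻¹) ≤ ε / 2 / x ^ j * x⁻¹ := by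
      have : 0 < y⁻¹ := inv_pos.2 hyd.1
      gcongr
      linarith
    have h4 : ‖u x / (x : ℂ) ^ (j + 2)‖
        ≤ ‖u y / (y : ℂ) ^ (j + 2)‖ + ε / 2 / x ^ j * x⁻¹ := by
      have := norm_sub_norm_le (u x / (x : ℂ) ^ (j + 2)) (u y / (y : ℂ) ^ (j + 2))
      rw [norm_sub_rev] at this
      linarith
    have hxc : (x : ℂ) ≠ 0 := by exact_mod_cast hx0.ne'
    have h5 : ‖u x / (x : ℂ)‖ = x ^ (j + 1) * ‖u x / (x : ℂ) ^ (j + 2)‖ := by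
      have : u x / (x : ℂ) = (x : ℂ) ^ (j + 1) * (u x / (x : ℂ) ^ (j + 2)) := by
        field_simp
        ring
      rw [this, norm_mul, norm_pow, Complex.norm_real, Real.norm_of_nonneg hx0.le]
    rw [h5]
    refine (mul_le_mul_of_nonneg_left h4 (by positivity)).trans_eq ?_
    rw [mul_add]
    congr 1
    field_simp
    ring
  have hlim : Tendsto (fun x : ℝ => x ^ (j + 1) * ‖u y / (y : ℂ) ^ (j + 2)‖ + ε / 2) (𝓝[>] 0)
      (𝓝 (ε / 2)) := by
    have : Continuous fun x : ℝ => x ^ (j + 1) * ‖u y / (y : ℂ) ^ (j + 2)‖ + ε / 2 := by fun_prop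
    have := (this.tendsto 0).mono_left (nhdsWithin_le_nhds (s := Ioi 0))
    simpa using this
  filter_upwards [hlim.eventually (gt_mem_nhds (half_lt_self hε)), Ioo_mem_nhdsGT hyd.1]
    with x hx1 hx2
  rw [Real.dist_eq, sub_zero, abs_of_nonneg (norm_nonneg _)]
  exact (key x hx2).trans_lt hx1

/-- For `k = 1`, the vanishing of `u` at the pole forces `r² u' - r u → 0`. -/
theorem pole_limit_eq_zero {c : ℂ} (hu : ∀ r ∈ Ioo (0 : ℝ) 1, DifferentiableAt ℝ u r)
    (hQ : Tendsto (fun r : ℝ => (r : ℂ) ^ 2 * deriv u r - r * u r) (𝓝[>] 0) (𝓝 c))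
    (h0 : Tendsto u (𝓝[>] 0) (𝓝 0)) : c = 0 := by
  by_contra hc
  have hc' : 0 < ‖c‖ := norm_pos_iff.2 hc
  set ε := ‖c‖ / 8 with hε
  have hε0 : 0 < ε := by positivity
  obtain ⟨d, hd, hdN⟩ := (mem_nhdsGT_iff_exists_Ioo_subset).1
    (((Metric.tendsto_nhds.1 hQ ε hε0).and (Metric.tendsto_nhds.1 h0 ε hε0)).and
      eventually_mem_right)
  have hd0 : (0 : ℝ) < d := hd
  set x := d / 4 with hxd
  have hx0 : 0 < x := by positivity
  have hm : ∀ s ∈ Icc x (2 * x), s ∈ Ioo 0 d := fun s hs => by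
    constructor <;> [linarith [hs.1]; linarith [hs.2]]
  have hx1 : 2 * x < 1 := (hdN (hm (2 * x) ⟨by linarith, le_rfl⟩)).2.2
  have hxc : (x : ℂ) ≠ 0 := by exact_mod_cast hx0.ne'
  -- Adding $c/(2s^2)$ cancels the leading term $c/s^3$ of the derivative. Between $x$ and $2x$ the
  -- added term changes by $-\tfrac38c/x^2$, which is too large for $\varepsilon=\|c\|/8$.
  have hder : ∀ s ∈ Icc x (2 * x), HasDerivWithinAt
      (fun s : ℝ => u s / (s : ℂ) + c / 2 * ((s : ℂ) ^ 2)⁻¹)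
      (((s : ℂ) ^ 2 * deriv u s - s * u s - c) / (s : ℂ) ^ 3) (Icc x (2 * x)) s := by
    intro s hs
    have hs0 : (s : ℂ) ≠ 0 := by exact_mod_cast (hm s hs).1.ne'
    have d1 := (hu s (hdN (hm s hs)).2).hasDerivAt.fun_div (hasDerivAt_id s).ofReal_comp hs0
    have d2 := ((hasDerivAt_ofReal_pow 2 s).fun_inv (pow_ne_zero 2 hs0)).const_mul (c / 2)
    refine ((d1.add d2).congr_deriv ?_).hasDerivWithinAt
    simp only [id, Complex.ofReal_one]
    field_simp
    push_cast
    ring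
  have hb : ∀ s ∈ Icc x (2 * x),
      ‖((s : ℂ) ^ 2 * deriv u s - s * u s - c) / (s : ℂ) ^ 3‖ ≤ ε / x ^ 3 := by
    intro s hs
    have hs0 := (hm s hs).1
    rw [norm_div, norm_pow, Complex.norm_real, Real.norm_of_nonneg hs0.le]
    have := (hdN (hm s hs)).1.1
    rw [dist_eq_norm] at this
    gcongr
    exact hs.1
  have hmv := (convex_Icc x (2 * x)).norm_image_sub_le_of_norm_hasDerivWithin_le hder hb
    (left_mem_Icc.2 (by linarith)) (right_mem_Icc.2 (by linarith))
  have hx2 : ‖2 * x - x‖ = x := by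
    rw [Real.norm_of_nonneg] <;> linarith
  rw [hx2] at hmv
  have e1 : u (2 * x) / ((2 * x : ℝ) : ℂ) + c / 2 * (((2 * x : ℝ) : ℂ) ^ 2)⁻¹
      - (u x / (x : ℂ) + c / 2 * ((x : ℂ) ^ 2)⁻¹)
      = (x * u (2 * x) / 2 - x * u x - 3 / 8 * c) / (x : ℂ) ^ 2 := by
    push_cast
    field_simp
    ring
  rw [e1, norm_div, norm_pow, Complex.norm_real, Real.norm_of_nonneg hx0.le,
    div_le_iff₀ (by positivity)] at hmv
  have e2 : ε / x ^ 3 * x * x ^ 2 = ε := by field_simp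
  rw [e2] at hmv
  have b1 : ‖u (2 * x)‖ ≤ ε := by
    have := (hdN (hm (2 * x) ⟨by linarith, le_rfl⟩)).1.2
    rw [dist_zero_right] at this
    exact this.le
  have b2 : ‖u x‖ ≤ ε := by
    have := (hdN (hm x ⟨le_rfl, by linarith⟩)).1.2
    rw [dist_zero_right] at this
    exact this.le
  have e3 : ‖(3 / 8 * c : ℂ)‖ ≤ ‖(x * u (2 * x) / 2 - x * u x - 3 / 8 * c : ℂ)‖
      + ‖(x * u (2 * x) / 2 - x * u x : ℂ)‖ := by
    have := norm_sub_le (x * u (2 * x) / 2 - x * u x : ℂ) (x * u (2 * x) / 2 - x * u x - 3 / 8 * c)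
    rw [sub_sub_cancel] at this
    linarith
  have e4 : ‖(x * u (2 * x) / 2 - x * u x : ℂ)‖ ≤ x * ε / 2 + x * ε := by
    refine (norm_sub_le _ _).trans ?_
    rw [norm_div, norm_mul, norm_mul, Complex.norm_real, Real.norm_of_nonneg hx0.le]
    simp only [Complex.norm_ofNat]
    gcongr
  have e5 : ‖(3 / 8 * c : ℂ)‖ = 3 / 8 * ‖c‖ := by
    rw [norm_mul]; norm_num
  rw [e5] at e3
  nlinarith

end FirstOrder

/-! ### First-order form of the radial Laplacian and pointwise energy bounds. -/

section Decomposition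

variable {m : ℤ} {u : ℝ → ℂ}

/-- The weighted radial Laplacian `√r (u'' + u'/r - m² u/r²)`. -/
def weightedLaplacian (m : ℤ) (u : ℝ → ℂ) (r : ℝ) : ℂ := (√r : ℂ) * radialLaplacian m u r

theorem norm_sq_weightedLaplacian {r : ℝ} (hr : 0 ≤ r) :
    ‖weightedLaplacian m u r‖ ^ 2 = ‖radialLaplacian m u r‖ ^ 2 * r := by
  rw [weightedLaplacian, norm_mul, mul_pow, Complex.norm_real, Real.norm_of_nonneg
    (Real.sqrt_nonneg r), Real.sq_sqrt hr, mul_comm]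

theorem memLp_weightedLaplacian (hu : MemH2 m u) :
    MemLp (weightedLaplacian m u) 2 (volume.restrict (Ioo 0 1)) := by
  have hmeas : AEStronglyMeasurable (weightedLaplacian m u) (volume.restrict (Ioo 0 1)) :=
    (Complex.measurable_ofReal.comp Real.continuous_sqrt.measurable).aestronglyMeasurable.mul
      (measurable_radialLaplacian hu)
  rw [memLp_two_iff_integrable_sq_norm hmeas]
  refine hu.finite_energy.congr ?_
  filter_upwards [ae_restrict_mem measurableSet_Ioo] with r hr
  exact (norm_sq_weightedLaplacian hr.1.le).symm

theorem intCast_sq_eq (m : ℤ) : (m : ℂ) ^ 2 = (m.natAbs : ℂ) ^ 2 := by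
  rw [← Int.cast_natCast m.natAbs, ← Int.cast_pow, ← Int.cast_pow, Int.natAbs_sq]

theorem MemH2.continuousOn_deriv (hu : MemH2 m u) : ContinuousOn (deriv u) (Ioo 0 1) := by
  intro r hr
  have h := (hu.locally_ac_deriv (r / 2) ((r + 1) / 2) (by linarith [hr.1])
    (by linarith [hr.1]) (by linarith [hr.2])).continuousOn
  rw [uIcc_of_le (by linarith [hr.1])] at h
  exact (h.continuousAt (Icc_mem_nhds (by linarith [hr.1]) (by linarith [hr.2]))).continuousWithinAt

/-- The left side is $r^{2k+1}(r^{-k}u)'$ with $k=|m|$; its derivative is $r^{k+1}$ times the radial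
Laplacian, that is, the integrand of `moment`. -/
theorem exists_first_order (hu : MemH2 m u) : ∃ c, ∀ r ∈ Ioo (0 : ℝ) 1,
    (r : ℂ) ^ (m.natAbs + 1) * deriv u r - m.natAbs * (r : ℂ) ^ m.natAbs * u r
      = c + moment m.natAbs (weightedLaplacian m u) r := by
  refine exists_eq_const_add_integral (fun a b ha hab hb => ?_)
    (intervalIntegrable_moment _ (memLp_weightedLaplacian hu)) ?_
  · have hmem : ∀ r ∈ uIcc a b, r ∈ Ioo (0 : ℝ) 1 := fun r hr => by
      rw [uIcc_of_le hab.le] at hr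
      exact ⟨ha.trans_le hr.1, hr.2.trans_lt hb⟩
    have hac : AbsolutelyContinuousOnInterval u a b :=
      ac_of_continuousOn_deriv (fun r hr => hu.differentiableAt (hmem r hr))
        (hu.continuousOn_deriv.mono hmem)
    exact ((ac_pow _ a b).smul (hu.locally_ac_deriv a b ha hab hb)).sub
      (((ac_pow _ a b).const_smul (m.natAbs : ℂ)).smul hac)
  · filter_upwards [hu.ae_differentiableAt_deriv] with r h2 hr
    have hr' : (r : ℂ) ≠ 0 := by exact_mod_cast hr.1.ne'
    have d1 := (hasDerivAt_ofReal_pow (m.natAbs + 1) r).fun_mul (h2 hr).hasDerivAt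
    have d2 := ((hasDerivAt_ofReal_pow m.natAbs r).const_mul (m.natAbs : ℂ)).fun_mul
      (hu.differentiableAt hr).hasDerivAt
    refine (d1.fun_sub d2).congr_deriv ?_
    have hs : ((√r : ℝ) : ℂ) * ((√r : ℝ) : ℂ) = r := by
      exact_mod_cast Real.mul_self_sqrt hr.1.le
    simp only [weightedLaplacian, radialLaplacian, intCast_sq_eq, Complex.ofReal_mul,
      Complex.ofReal_pow, Nat.add_sub_cancel]
    generalize m.natAbs = k
    generalize deriv (deriv u) r = w2
    generalize deriv u r = w1
    generalize u r = w0
    have e : (r : ℂ) ^ k * (√r : ℂ) * ((√r : ℂ) * (w2 + w1 / r - (k : ℂ) ^ 2 / (r : ℂ) ^ 2 * w0))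
        = (r : ℂ) ^ k * r * (w2 + w1 / r - (k : ℂ) ^ 2 / (r : ℂ) ^ 2 * w0) := by
      rw [← hs]; ring
    rw [e]
    rcases k with _ | j
    · simp
      field_simp
      ring
    · simp only [Nat.add_sub_cancel]
      push_cast
      field_simp
      ring

/-- The pole conditions kill the constant, by three mechanisms: for $m=0$ because $u'\to0$, for
$|m|=1$ by `pole_limit_eq_zero` since only $u\to0$ is known, and for $|m|\ge2$ because both $u$ and
$u'$ tend to zero. -/
theorem first_order_eq (hu : MemH2 m u) : ∀ r ∈ Ioo (0 : ℝ) 1,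
    (r : ℂ) ^ (m.natAbs + 1) * deriv u r - m.natAbs * (r : ℂ) ^ m.natAbs * u r
      = moment m.natAbs (weightedLaplacian m u) r := by
  obtain ⟨c, hc⟩ := exists_first_order hu
  suffices h0 : c = 0 by simpa [h0] using hc
  have hlim : Tendsto (fun r : ℝ => (r : ℂ) ^ (m.natAbs + 1) * deriv u r
      - m.natAbs * (r : ℂ) ^ m.natAbs * u r) (𝓝[>] 0) (𝓝 c) := by
    have := (tendsto_moment_zero m.natAbs (memLp_weightedLaplacian hu)).const_add c
    rw [add_zero] at this
    refine this.congr' ?_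
    filter_upwards [eventually_mem_right] with r hr using (hc r hr).symm
  have hpow : ∀ n : ℕ, Tendsto (fun r : ℝ => (r : ℂ) ^ n) (𝓝[>] 0) (𝓝 ((0 : ℝ) ^ n : ℂ)) := by
    intro n
    have : Continuous fun r : ℝ => (r : ℂ) ^ n := by fun_prop
    simpa using (this.tendsto 0).mono_left (nhdsWithin_le_nhds (s := Ioi 0))
  by_cases hm0 : m = 0
  · subst hm0
    have h1 := hu.pole_deriv
    have h2 := (hpow 1).mul h1
    refine tendsto_nhds_unique hlim ?_
    simpa using h2
  have hval : Tendsto u (𝓝[>] 0) (𝓝 0) := by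
    have hmc : (m : ℂ) ≠ 0 := by exact_mod_cast hm0
    have := hu.pole_value.const_mul (m : ℂ)⁻¹
    rw [mul_zero] at this
    refine this.congr fun r => ?_
    rw [inv_mul_cancel_left₀ hmc]
  by_cases hm1 : m.natAbs = 1
  · refine pole_limit_eq_zero (fun r hr => hu.differentiableAt hr) ?_ hval
    simpa [hm1] using hlim
  have hder : Tendsto (deriv u) (𝓝[>] 0) (𝓝 0) := by
    have hmc : (1 - (m : ℂ) ^ 2) ≠ 0 := by
      rw [intCast_sq_eq, sub_ne_zero]
      intro h
      have h' : m.natAbs ^ 2 = 1 := by exact_mod_cast h.symm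
      exact hm1 (by simpa using h')
    have := hu.pole_deriv.const_mul (1 - (m : ℂ) ^ 2)⁻¹
    rw [mul_zero] at this
    refine this.congr fun r => ?_
    rw [inv_mul_cancel_left₀ hmc]
  refine tendsto_nhds_unique hlim ?_
  have := ((hpow (m.natAbs + 1)).mul hder).sub
    (((hpow m.natAbs).const_mul (m.natAbs : ℂ)).mul hval)
  simpa using this

/-- Letting $r\to1$ in the first-order equation, both conditions at $r=1$ enter. This is the only
linear constraint on the weighted Laplacian of an element of $H_m$. -/
theorem moment_one_eq_zero (hu : MemH2 m u) :
    moment m.natAbs (weightedLaplacian m u) 1 = 0 := by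
  refine tendsto_nhds_unique (tendsto_moment_one _ (memLp_weightedLaplacian hu)) ?_
  have hpow : ∀ n : ℕ, Tendsto (fun r : ℝ => (r : ℂ) ^ n) (𝓝[<] 1) (𝓝 1) := by
    intro n
    have : Continuous fun r : ℝ => (r : ℂ) ^ n := by fun_prop
    simpa using (this.tendsto 1).mono_left (nhdsWithin_le_nhds (s := Iio 1))
  have := ((hpow (m.natAbs + 1)).mul hu.boundary_deriv).sub
    (((hpow m.natAbs).const_mul (m.natAbs : ℂ)).mul hu.boundary_value)
  simp only [mul_zero, sub_zero] at this
  refine this.congr' ?_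
  filter_upwards [eventually_mem_left] with r hr using first_order_eq hu r hr

theorem norm_moment_le_const (k : ℕ) {h : ℝ → ℂ} (hh : MemLp h 2 (volume.restrict (Ioo 0 1)))
    {r : ℝ} (hr : r ∈ Ioo (0 : ℝ) 1) : ‖moment k h r‖ ≤ r ^ (k + 1) * tailNorm h 1 := by
  refine (norm_moment_le k hh hr.1 hr.2.le).trans ?_
  have := hr.1
  gcongr
  exact tailNorm_mono hh hr.1.le hr.2.le

/-- Pointwise control of `(|m|/√r) u` by the energy. -/
theorem natAbs_mul_norm_le (hu : MemH2 m u) {r : ℝ} (hr : r ∈ Ioo (0 : ℝ) 1) :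
    m.natAbs * ‖u r‖ ≤ 2 * m.natAbs * tailNorm (weightedLaplacian m u) 1 * √r := by
  by_cases hm0 : m.natAbs = 0
  · simp [hm0]
  have := norm_le_two_mul_sqrt hm0 (N := tailNorm (weightedLaplacian m u) 1) (Real.sqrt_nonneg _)
    (fun r hr => hu.differentiableAt hr) (first_order_eq hu)
    (fun r hr => norm_moment_le_const _ (memLp_weightedLaplacian hu) hr) hu.boundary_value hr
  calc (m.natAbs : ℝ) * ‖u r‖
      ≤ m.natAbs * (2 * tailNorm (weightedLaplacian m u) 1 * √r) := by gcongr
    _ = _ := by ring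

/-- Pointwise control of `√r u'` by the energy. -/
theorem sqrt_mul_norm_deriv_le (hu : MemH2 m u) {r : ℝ} (hr : r ∈ Ioo (0 : ℝ) 1) :
    √r * ‖deriv u r‖ ≤ (1 + 2 * m.natAbs) * tailNorm (weightedLaplacian m u) 1 := by
  have hr0 := hr.1
  have hrc : (r : ℂ) ≠ 0 := by exact_mod_cast hr0.ne'
  have hs : 0 < √r := Real.sqrt_pos.2 hr0
  have hs1 : √r ≤ 1 := Real.sqrt_le_one.2 hr.2.le
  have hsq : √r * √r = r := Real.mul_self_sqrt hr0.le
  set N := tailNorm (weightedLaplacian m u) 1 with hN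
  have hN0 : 0 ≤ N := Real.sqrt_nonneg _
  have h1 := norm_moment_le_const m.natAbs (memLp_weightedLaplacian hu) hr
  have h2 := natAbs_mul_norm_le hu hr
  rw [← hN] at h1 h2
  have h3 : (r : ℂ) ^ m.natAbs * (r * deriv u r)
      = moment m.natAbs (weightedLaplacian m u) r + (r : ℂ) ^ m.natAbs * (m.natAbs * u r) := by
    rw [← first_order_eq hu r hr]; ring
  have h4 : r ^ m.natAbs * (r * ‖deriv u r‖)
      ≤ r ^ (m.natAbs + 1) * N + r ^ m.natAbs * (m.natAbs * ‖u r‖) := by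
    have h5 := congrArg norm h3
    have h6 := norm_add_le (moment m.natAbs (weightedLaplacian m u) r)
      ((r : ℂ) ^ m.natAbs * (m.natAbs * u r))
    rw [← h5] at h6
    simp only [norm_mul, norm_pow, Complex.norm_real, Real.norm_of_nonneg hr0.le,
      Complex.norm_natCast] at h6
    linarith
  have h5 : r * ‖deriv u r‖ ≤ r * N + m.natAbs * ‖u r‖ := by
    have : r ^ m.natAbs * (r * ‖deriv u r‖) ≤ r ^ m.natAbs * (r * N + m.natAbs * ‖u r‖) := by
      refine h4.trans_eq ?_
      ring
    exact le_of_mul_le_mul_left this (by positivity)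
  -- The first-order equation bounds $r|u'|$ by $rN+|m||u|$, and the bound on $u$ brings a factor
  -- $\sqrt r$; as $r\le\sqrt r$, one $\sqrt r$ can be cancelled.
  have h6 : √r * (√r * ‖deriv u r‖) ≤ √r * ((1 + 2 * m.natAbs) * N) := by
    calc √r * (√r * ‖deriv u r‖) = r * ‖deriv u r‖ := by rw [← mul_assoc, hsq]
      _ ≤ r * N + 2 * m.natAbs * N * √r := by linarith
      _ ≤ √r * N + 2 * m.natAbs * N * √r := by
        have : r ≤ √r := by nlinarith
        gcongr
      _ = _ := by ring
  exact le_of_mul_le_mul_left h6 hs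

end Decomposition

/-! ### Solving the radial equation with an arbitrary square-integrable right side. -/

section Inverse

/-- The solution `r ↦ -rᵏ ∫ᵣ¹ s⁻²ᵏ⁻¹ (∫₀ˢ tᵏ √t h(t) dt) ds` of `√r (u'' + u'/r - k² u/r²) = h`. -/
def radialSolution (k : ℕ) (h : ℝ → ℂ) : ℝ → ℂ :=
  (Ioo (0 : ℝ) 1).indicator fun r =>
    (r : ℂ) ^ k * -∫ s in r..1, moment k h s / (s : ℂ) ^ (2 * k + 1)

variable {h : ℝ → ℂ} (k : ℕ)

theorem continuousOn_moment_div (hh : MemLp h 2 (volume.restrict (Ioo 0 1))) (n : ℕ) :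
    ContinuousOn (fun s : ℝ => moment k h s / (s : ℂ) ^ n) (Ioc 0 1) := by
  refine ((continuousOn_moment k hh).mono Ioc_subset_Icc_self).div (by fun_prop) fun s hs => ?_
  exact pow_ne_zero _ (by exact_mod_cast hs.1.ne')

theorem hasDerivAt_radialSolution (hh : MemLp h 2 (volume.restrict (Ioo 0 1))) {r : ℝ}
    (hr : r ∈ Ioo (0 : ℝ) 1) :
    HasDerivAt (radialSolution k h)
      (k * (radialSolution k h r / r) + moment k h r / (r : ℂ) ^ (k + 1)) r := by
  have hrc : (r : ℂ) ≠ 0 := by exact_mod_cast hr.1.ne'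
  have hc := continuousOn_moment_div k hh (2 * k + 1)
  have hint : IntervalIntegrable (fun s : ℝ => moment k h s / (s : ℂ) ^ (2 * k + 1)) volume r 1 := by
    refine (hc.mono ?_).intervalIntegrable
    rw [uIcc_of_le hr.2.le]
    exact fun s hs => ⟨hr.1.trans_le hs.1, hs.2⟩
  have hG := intervalIntegral.integral_hasDerivAt_left hint
    ((hc.mono Ioo_subset_Ioc_self).stronglyMeasurableAtFilter isOpen_Ioo r hr)
    ((hc.mono Ioo_subset_Ioc_self).continuousAt (isOpen_Ioo.mem_nhds hr))
  have hd := (hasDerivAt_ofReal_pow k r).fun_mul hG.fun_neg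
  have he : radialSolution k h =ᶠ[𝓝 r]
      fun r : ℝ => (r : ℂ) ^ k * -∫ s in r..1, moment k h s / (s : ℂ) ^ (2 * k + 1) :=
    (eqOn_indicator).eventuallyEq_of_mem (isOpen_Ioo.mem_nhds hr)
  refine (hd.congr_of_eventuallyEq he).congr_deriv ?_
  rw [he.eq_of_nhds]
  rcases k with _ | j
  · simp
  · simp only [Nat.add_sub_cancel]
    field_simp
    ring

theorem deriv_radialSolution (hh : MemLp h 2 (volume.restrict (Ioo 0 1))) {r : ℝ}
    (hr : r ∈ Ioo (0 : ℝ) 1) : deriv (radialSolution k h) r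
      = k * (radialSolution k h r / r) + moment k h r / (r : ℂ) ^ (k + 1) :=
  (hasDerivAt_radialSolution k hh hr).deriv

theorem radialSolution_first_order (hh : MemLp h 2 (volume.restrict (Ioo 0 1))) {r : ℝ}
    (hr : r ∈ Ioo (0 : ℝ) 1) : (r : ℂ) ^ (k + 1) * deriv (radialSolution k h) r
      - k * (r : ℂ) ^ k * radialSolution k h r = moment k h r := by
  have hrc : (r : ℂ) ≠ 0 := by exact_mod_cast hr.1.ne'
  rw [deriv_radialSolution k hh hr]
  field_simp
  ring

theorem radialSolution_tendsto_one (hh : MemLp h 2 (volume.restrict (Ioo 0 1))) :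
    Tendsto (radialSolution k h) (𝓝[<] 1) (𝓝 0) := by
  have hc := continuousOn_moment_div k hh (2 * k + 1)
  have hint : IntegrableOn (fun s : ℝ => moment k h s / (s : ℂ) ^ (2 * k + 1))
      (uIcc (1 / 2 : ℝ) 1) := by
    rw [uIcc_of_le (by norm_num)]
    refine (hc.mono fun s hs => ⟨?_, hs.2⟩).integrableOn_Icc
    linarith [hs.1]
  have h1 := (intervalIntegral.continuousOn_primitive_interval_left hint) 1 (by simp)
  have h2 : 𝓝[<] (1 : ℝ) ≤ 𝓝[uIcc (1 / 2 : ℝ) 1] 1 := by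
    rw [uIcc_of_le (by norm_num)]
    exact nhdsWithin_le_of_mem
      (mem_of_superset (Ioo_mem_nhdsLT (by norm_num : (1 / 2 : ℝ) < 1)) Ioo_subset_Icc_self)
  have h3 := h1.tendsto.mono_left h2
  rw [intervalIntegral.integral_same] at h3
  have hpow : Tendsto (fun r : ℝ => (r : ℂ) ^ k) (𝓝[<] 1) (𝓝 1) := by
    have : Continuous fun r : ℝ => (r : ℂ) ^ k := by fun_prop
    simpa using (this.tendsto 1).mono_left (nhdsWithin_le_nhds (s := Iio 1))
  have h4 := hpow.mul h3.neg
  rw [neg_zero, mul_zero] at h4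
  refine h4.congr' ?_
  filter_upwards [eventually_mem_left] with r hr
  rw [radialSolution, indicator_of_mem hr]

theorem tendsto_moment_div_zero (hh : MemLp h 2 (volume.restrict (Ioo 0 1))) :
    Tendsto (fun r : ℝ => moment k h r / (r : ℂ) ^ (k + 1)) (𝓝[>] 0) (𝓝 0) := by
  rw [tendsto_zero_iff_norm_tendsto_zero]
  refine squeeze_zero' (Eventually.of_forall fun _ => norm_nonneg _) ?_ (tendsto_tailNorm hh)
  filter_upwards [eventually_mem_right] with r hr
  have hr0 := hr.1
  rw [norm_div, norm_pow, Complex.norm_real, Real.norm_of_nonneg hr0.le,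
    div_le_iff₀ (by positivity), mul_comm]
  exact norm_moment_le k hh hr0 hr.2.le

theorem ac_inv_pow (n : ℕ) {a b : ℝ} (ha : 0 < a) (hab : a < b) :
    AbsolutelyContinuousOnInterval (fun r : ℝ => ((r : ℂ) ^ n)⁻¹) a b := by
  refine ContDiffOn.absolutelyContinuousOnInterval
    (((Complex.ofRealCLM.contDiff.pow n).contDiffOn).inv fun r hr => ?_)
  rw [uIcc_of_le hab.le] at hr
  exact pow_ne_zero _ (Complex.ofReal_ne_zero.2 (ha.trans_le hr.1).ne')

theorem ac_deriv_radialSolution (hh : MemLp h 2 (volume.restrict (Ioo 0 1))) {a b : ℝ}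
    (ha : 0 < a) (hab : a < b) (hb : b < 1) :
    AbsolutelyContinuousOnInterval (deriv (radialSolution k h)) a b := by
  have hmem : ∀ r ∈ uIcc a b, r ∈ Ioo (0 : ℝ) 1 := fun r hr => by
    rw [uIcc_of_le hab.le] at hr
    exact ⟨ha.trans_le hr.1, hr.2.trans_lt hb⟩
  have hdiff : ∀ r ∈ uIcc a b, DifferentiableAt ℝ (radialSolution k h) r := fun r hr =>
    (hasDerivAt_radialSolution k hh (hmem r hr)).differentiableAt
  have hcont : ContinuousOn (deriv (radialSolution k h)) (uIcc a b) := by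
    have h1 : ContinuousOn (radialSolution k h) (uIcc a b) := fun r hr =>
      (hdiff r hr).continuousAt.continuousWithinAt
    have h2 : ContinuousOn (fun r : ℝ => k * (radialSolution k h r / (r : ℂ))
        + moment k h r / (r : ℂ) ^ (k + 1)) (uIcc a b) := by
      refine (continuousOn_const.mul (h1.div (by fun_prop) fun r hr => ?_)).add
        ((continuousOn_moment_div k hh (k + 1)).mono fun r hr => Ioo_subset_Ioc_self (hmem r hr))
      exact_mod_cast (hmem r hr).1.ne'
    exact h2.congr fun r hr => deriv_radialSolution k hh (hmem r hr)
  have hac := ac_of_continuousOn_deriv hdiff hcont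
  have hmom : AbsolutelyContinuousOnInterval (moment k h) a b :=
    (ac_intervalIntegral (intervalIntegrable_moment k hh) (by simp)).mono fun r hr => by
      rw [uIcc_of_le zero_le_one]
      exact Ioo_subset_Icc_self (hmem r hr)
  refine ac_congr (fun r hr => ?_) (((hac.smul (ac_inv_pow 1 ha hab)).const_smul (k : ℂ)).add
    (hmom.smul (ac_inv_pow (k + 1) ha hab)))
  rw [deriv_radialSolution k hh (hmem r hr)]
  simp [div_eq_mul_inv]

theorem weightedLaplacian_radialSolution (m : ℤ) (hh : MemLp h 2 (volume.restrict (Ioo 0 1))) :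
    ∀ᵐ r, r ∈ Ioo (0 : ℝ) 1 → weightedLaplacian m (radialSolution m.natAbs h) r = h r := by
  filter_upwards [(intervalIntegrable_moment m.natAbs hh).ae_hasDerivAt_integral] with r h1 hr
  have hrI : r ∈ uIcc (0 : ℝ) 1 := by
    rw [uIcc_of_le zero_le_one]; exact Ioo_subset_Icc_self hr
  have hP : HasDerivAt (moment m.natAbs h) (((r ^ m.natAbs * √r : ℝ) : ℂ) * h r) r :=
    h1 hrI 0 (by simp)
  have hrc : (r : ℂ) ≠ 0 := by exact_mod_cast hr.1.ne'
  have hs0 : ((√r : ℝ) : ℂ) ≠ 0 := by exact_mod_cast (Real.sqrt_pos.2 hr.1).ne'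
  have hs : ((√r : ℝ) : ℂ) * ((√r : ℝ) : ℂ) = r := by
    exact_mod_cast Real.mul_self_sqrt hr.1.le
  have he : deriv (radialSolution m.natAbs h) =ᶠ[𝓝 r] fun r : ℝ =>
      m.natAbs * (radialSolution m.natAbs h r / r) + moment m.natAbs h r / (r : ℂ) ^ (m.natAbs + 1) :=
    EqOn.eventuallyEq_of_mem (s := Ioo 0 1) (fun s hs => deriv_radialSolution m.natAbs hh hs)
      (isOpen_Ioo.mem_nhds hr)
  have hd1 := ((hasDerivAt_radialSolution m.natAbs hh hr).fun_div
    (hasDerivAt_id r).ofReal_comp hrc).const_mul (m.natAbs : ℂ)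
  have hd2 := hP.fun_div (hasDerivAt_ofReal_pow (m.natAbs + 1) r) (pow_ne_zero _ hrc)
  have hd := ((hd1.fun_add hd2).congr_of_eventuallyEq he).deriv
  rw [weightedLaplacian, radialLaplacian, hd, deriv_radialSolution m.natAbs hh hr, intCast_sq_eq]
  simp only [id, Complex.ofReal_one, Complex.ofReal_mul, Complex.ofReal_pow, Nat.add_sub_cancel]
  generalize radialSolution m.natAbs h r = w0
  generalize moment m.natAbs h r = w1
  generalize m.natAbs = k
  push_cast
  rw [← hs]
  field_simp
  ring

/-- All requirements except $u'(1)=0$ hold for every $h\in L^2$; the vanishing moment is needed for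
that condition alone. -/
theorem memH2_radialSolution {m : ℤ} (hh : MemLp h 2 (volume.restrict (Ioo 0 1)))
    (h1 : moment m.natAbs h 1 = 0) : MemH2 m (radialSolution m.natAbs h) where
  eq_zero_outside r hr := indicator_of_notMem hr _
  differentiableOn r hr :=
    (hasDerivAt_radialSolution _ hh hr).differentiableAt.differentiableWithinAt
  locally_ac_deriv a b ha hab hb := ac_deriv_radialSolution _ hh ha hab hb
  finite_energy := by
    refine (hh.integrable_norm_pow two_ne_zero).congr ?_
    rw [EventuallyEq, ae_restrict_iff' measurableSet_Ioo]
    filter_upwards [weightedLaplacian_radialSolution m hh] with r h2 hr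
    rw [← norm_sq_weightedLaplacian hr.1.le, h2 hr]
  pole_value := by
    by_cases hm : m.natAbs = 0
    · simp [Int.natAbs_eq_zero.1 hm]
    suffices h2 : Tendsto (radialSolution m.natAbs h) (𝓝[>] 0) (𝓝 0) by
      simpa using h2.const_mul (m : ℂ)
    rw [tendsto_zero_iff_norm_tendsto_zero]
    have h3 : Tendsto (fun r : ℝ => 2 * tailNorm h 1 * √r) (𝓝[>] 0) (𝓝 0) := by
      have : Continuous fun r : ℝ => 2 * tailNorm h 1 * √r := by fun_prop
      simpa using (this.tendsto 0).mono_left (nhdsWithin_le_nhds (s := Ioi 0))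
    refine squeeze_zero' (Eventually.of_forall fun _ => norm_nonneg _) ?_ h3
    filter_upwards [eventually_mem_right] with r hr
    exact norm_le_two_mul_sqrt hm (Real.sqrt_nonneg _)
      (fun r hr => (hasDerivAt_radialSolution _ hh hr).differentiableAt)
      (fun r hr => radialSolution_first_order _ hh hr)
      (fun r hr => norm_moment_le_const _ hh hr) (radialSolution_tendsto_one _ hh) hr
  pole_deriv := by
    -- For $|m|=1$ the factor $1-m^2$ is zero and nothing is claimed about $u'$. For $|m|\ge2$ the
    -- term $u/r$ tends to zero; for $m=0$ its coefficient is zero.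
    by_cases hm1 : m.natAbs = 1
    · rw [intCast_sq_eq, hm1]
      simp
    suffices h2 : Tendsto (deriv (radialSolution m.natAbs h)) (𝓝[>] 0) (𝓝 0) by
      simpa using h2.const_mul (1 - (m : ℂ) ^ 2)
    have h3 : Tendsto (fun r : ℝ => (m.natAbs : ℂ) * (radialSolution m.natAbs h r / r)) (𝓝[>] 0)
        (𝓝 0) := by
      by_cases hm : m.natAbs = 0
      · simp [hm]
      have h4 := tendsto_div_zero (k := m.natAbs) (by omega)
        (fun r hr => (hasDerivAt_radialSolution _ hh hr).differentiableAt)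
        (fun r hr => radialSolution_first_order _ hh hr)
        (fun r hr => norm_moment_le _ hh hr.1 hr.2.le) (tendsto_tailNorm hh)
      simpa using h4.const_mul (m.natAbs : ℂ)
    have h5 := h3.add (tendsto_moment_div_zero m.natAbs hh)
    rw [add_zero] at h5
    refine h5.congr' ?_
    filter_upwards [eventually_mem_right] with r hr
    exact (deriv_radialSolution _ hh hr).symm
  boundary_value := radialSolution_tendsto_one _ hh
  boundary_deriv := by
    have hpow : ∀ n : ℕ, Tendsto (fun r : ℝ => (r : ℂ) ^ n) (𝓝[<] 1) (𝓝 1) := by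
      intro n
      have : Continuous fun r : ℝ => (r : ℂ) ^ n := by fun_prop
      simpa using (this.tendsto 1).mono_left (nhdsWithin_le_nhds (s := Iio 1))
    have h2 := (((radialSolution_tendsto_one m.natAbs hh).div (hpow 1) one_ne_zero).const_mul
      (m.natAbs : ℂ)).add ((tendsto_moment_one m.natAbs hh).div (hpow (m.natAbs + 1)) one_ne_zero)
    rw [h1] at h2
    simp only [zero_div, mul_zero, add_zero, pow_one] at h2
    refine h2.congr' ?_
    filter_upwards [eventually_mem_left] with r hr
    exact (deriv_radialSolution _ hh hr).symm

end Inverse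

/-! ### The two forms as Hilbert space inner products; closed range and Hilbert–Schmidt bound. -/

section Realization

/-- The Hilbert space `L²(0,1)`. -/
abbrev L2 : Type := Lp ℂ 2 (volume.restrict (Ioo (0 : ℝ) 1))

theorem inner_toLp {f g : ℝ → ℂ} (hf : MemLp f 2 (volume.restrict (Ioo 0 1)))
    (hg : MemLp g 2 (volume.restrict (Ioo 0 1))) :
    inner ℂ (hf.toLp f) (hg.toLp g) = ∫ r in Ioo (0 : ℝ) 1, conj (f r) * g r := by
  rw [L2.inner_def]
  refine integral_congr_ae ?_
  filter_upwards [hf.coeFn_toLp, hg.coeFn_toLp] with r h1 h2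
  rw [h1, h2, RCLike.inner_apply, mul_comm]

theorem norm_sq_toLp {f : ℝ → ℂ} (hf : MemLp f 2 (volume.restrict (Ioo 0 1))) :
    ‖hf.toLp f‖ ^ 2 = ∫ r in Ioo (0 : ℝ) 1, ‖f r‖ ^ 2 := by
  have h1 := inner_toLp hf hf
  have h2 : ∀ r, conj (f r) * f r = ((‖f r‖ ^ 2 : ℝ) : ℂ) := fun r => by
    rw [Complex.conj_mul']; push_cast; rfl
  simp only [h2] at h1
  rw [integral_complex_ofReal] at h1
  rw [← inner_self_eq_norm_sq (𝕜 := ℂ), h1]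
  exact Complex.ofReal_re _

theorem tailNorm_one_eq {f : ℝ → ℂ} (hf : MemLp f 2 (volume.restrict (Ioo 0 1))) :
    tailNorm f 1 = ‖hf.toLp f‖ := by
  rw [tailNorm, intervalIntegral.integral_of_le zero_le_one, integral_Ioc_eq_integral_Ioo,
    ← norm_sq_toLp hf, Real.sqrt_sq (norm_nonneg _)]

theorem moment_one_eq_inner (k : ℕ) {q f : ℝ → ℂ} (hq : MemLp q 2 (volume.restrict (Ioo 0 1)))
    (hqk : ∀ r, q r = ((r ^ k * √r : ℝ) : ℂ)) (hf : MemLp f 2 (volume.restrict (Ioo 0 1))) :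
    moment k f 1 = inner ℂ (hq.toLp q) (hf.toLp f) := by
  rw [inner_toLp, moment, intervalIntegral.integral_of_le zero_le_one, integral_Ioc_eq_integral_Ioo]
  simp only [hqk, Complex.conj_ofReal]

/-- Linear functionals bounded by `‖A x‖` satisfy a Bessel inequality. -/
theorem sum_norm_sq_le {X E : Type*} [AddCommGroup X] [Module ℂ X] [NormedAddCommGroup E]
    [InnerProductSpace ℂ E] (A : X →ₗ[ℂ] E) (φ : X →ₗ[ℂ] ℂ) {C : ℝ}
    (hφ : ∀ x, ‖φ x‖ ≤ C * ‖A x‖) {n : ℕ} (e : Fin n → X) (he : Orthonormal ℂ fun i => A (e i)) :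
    ∑ i, ‖φ (e i)‖ ^ 2 ≤ C ^ 2 := by
  set σ := ∑ i, ‖φ (e i)‖ ^ 2 with hσ
  have hσ0 : 0 ≤ σ := Finset.sum_nonneg fun i _ => sq_nonneg _
  -- This $x$ represents $\varphi$ on the span of the family, so $\varphi(x)=\|Ax\|^2=\sigma$, and
  -- the bound on $\varphi$ gives $\sigma\le C\sqrt\sigma$.
  set x := ∑ i, conj (φ (e i)) • e i with hx
  have h1 : φ x = (σ : ℂ) := by
    rw [hx, map_sum, hσ]
    push_cast
    refine Finset.sum_congr rfl fun i _ => ?_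
    rw [map_smul, smul_eq_mul, Complex.conj_mul']
  have h2 : ‖A x‖ ^ 2 = σ := by
    have h3 : A x = ∑ i, conj (φ (e i)) • A (e i) := by simp [hx]
    have h4 := he.inner_sum (fun i => conj (φ (e i))) (fun i => conj (φ (e i))) Finset.univ
    rw [← h3] at h4
    have h5 : ∀ i, conj (conj (φ (e i))) * conj (φ (e i)) = ((‖φ (e i)‖ ^ 2 : ℝ) : ℂ) := fun i => by
      rw [Complex.conj_conj, Complex.mul_conj']; push_cast; rfl
    simp only [h5, ← Complex.ofReal_sum] at h4
    rw [← inner_self_eq_norm_sq (𝕜 := ℂ), h4]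
    exact Complex.ofReal_re _
  have h3 := hφ x
  rw [h1, Complex.norm_real, Real.norm_of_nonneg hσ0] at h3
  have h4 : σ ^ 2 ≤ C ^ 2 * σ := by
    have := pow_le_pow_left₀ hσ0 h3 2
    rwa [mul_pow, h2] at this
  rcases hσ0.eq_or_lt with h | h
  · rw [← h]; positivity
  · nlinarith

theorem sum_norm_sq_toLp_le {n : ℕ} {f : Fin n → ℝ → ℂ}
    (hf : ∀ i, MemLp (f i) 2 (volume.restrict (Ioo 0 1))) {C : ℝ}
    (hC : ∀ r ∈ Ioo (0 : ℝ) 1, ∑ i, ‖f i r‖ ^ 2 ≤ C) :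
    ∑ i, ‖(hf i).toLp (f i)‖ ^ 2 ≤ C := by
  simp only [norm_sq_toLp]
  rw [← integral_finsetSum _ fun i _ => (hf i).integrable_norm_pow two_ne_zero]
  calc ∫ r in Ioo (0 : ℝ) 1, ∑ i, ‖f i r‖ ^ 2 ≤ ∫ _ in Ioo (0 : ℝ) 1, C := by
        refine setIntegral_mono_on
          (integrable_finsetSum _ fun i _ => (hf i).integrable_norm_pow two_ne_zero)
          (integrable_const C) measurableSet_Ioo hC
    _ = C := by simp

variable {m : ℤ} {u v : ℝ → ℂ}

/-- `u ↦ √r (u'' + u'/r - m² u/r²)` as a linear map on `H2 m`. -/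
def energyMapOn (m : ℤ) : H2 m →ₗ[ℂ] L2 where
  toFun u := (memLp_weightedLaplacian u.2).toLp _
  map_add' u v := by
    rw [← MemLp.toLp_add, MemLp.toLp_eq_toLp_iff, EventuallyEq, ae_restrict_iff' measurableSet_Ioo]
    filter_upwards [radialLaplacian_add u.2 v.2] with r hr hrI
    simp only [weightedLaplacian, Pi.add_apply, Submodule.coe_add, hr hrI]
    ring
  map_smul' c u := by
    rw [RingHom.id_apply, ← MemLp.toLp_const_smul, MemLp.toLp_eq_toLp_iff, EventuallyEq,
      ae_restrict_iff' measurableSet_Ioo]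
    filter_upwards [radialLaplacian_smul c u.2] with r hr hrI
    simp only [weightedLaplacian, Pi.smul_apply, Submodule.coe_smul, hr hrI, smul_eq_mul]
    ring

/-- A linear extension of `energyMapOn` to all functions. -/
def energyMap (m : ℤ) : (ℝ → ℂ) →ₗ[ℂ] L2 := (LinearMap.exists_extend (energyMapOn m)).choose

theorem energyMap_apply (hu : MemH2 m u) :
    energyMap m u = (memLp_weightedLaplacian hu).toLp _ :=
  LinearMap.congr_fun (LinearMap.exists_extend (energyMapOn m)).choose_spec ⟨u, hu⟩

theorem tailNorm_eq_norm_energyMap (hu : MemH2 m u) :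
    tailNorm (weightedLaplacian m u) 1 = ‖energyMap m u‖ := by
  rw [energyMap_apply hu, tailNorm_one_eq]

theorem norm_sqrt_mul_deriv_le (hu : MemH2 m u) {r : ℝ} (hr : r ∈ Ioo (0 : ℝ) 1) :
    ‖(√r : ℂ) * deriv u r‖ ≤ (1 + 2 * m.natAbs) * ‖energyMap m u‖ := by
  rw [norm_mul, Complex.norm_real, Real.norm_of_nonneg (Real.sqrt_nonneg _),
    ← tailNorm_eq_norm_energyMap hu]
  exact sqrt_mul_norm_deriv_le hu hr

theorem norm_natAbs_div_sqrt_mul_le (hu : MemH2 m u) {r : ℝ} (hr : r ∈ Ioo (0 : ℝ) 1) :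
    ‖(m.natAbs : ℂ) / (√r : ℂ) * u r‖ ≤ 2 * m.natAbs * ‖energyMap m u‖ := by
  have hs : 0 < √r := Real.sqrt_pos.2 hr.1
  rw [norm_mul, norm_div, Complex.norm_real, Real.norm_of_nonneg hs.le, Complex.norm_natCast,
    ← tailNorm_eq_norm_energyMap hu, div_mul_eq_mul_div, div_le_iff₀ hs]
  exact natAbs_mul_norm_le hu hr

theorem memLp_sqrt_mul_deriv (hu : MemH2 m u) :
    MemLp (fun r : ℝ => (√r : ℂ) * deriv u r) 2 (volume.restrict (Ioo 0 1)) := by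
  refine MemLp.of_bound ?_ ((1 + 2 * m.natAbs) * ‖energyMap m u‖) ?_
  · exact ((Complex.measurable_ofReal.comp Real.continuous_sqrt.measurable).mul
      (measurable_deriv u)).aestronglyMeasurable
  · filter_upwards [ae_restrict_mem measurableSet_Ioo] with r hr
    exact norm_sqrt_mul_deriv_le hu hr

theorem memLp_natAbs_div_sqrt_mul (hu : MemH2 m u) :
    MemLp (fun r : ℝ => (m.natAbs : ℂ) / (√r : ℂ) * u r) 2 (volume.restrict (Ioo 0 1)) := by
  refine MemLp.of_bound ?_ (2 * m.natAbs * ‖energyMap m u‖) ?_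
  · exact (measurable_const.div
      (Complex.measurable_ofReal.comp Real.continuous_sqrt.measurable)).aestronglyMeasurable.mul
      (hu.differentiableOn.continuousOn.aestronglyMeasurable measurableSet_Ioo)
  · filter_upwards [ae_restrict_mem measurableSet_Ioo] with r hr
    exact norm_natAbs_div_sqrt_mul_le hu hr

/-- `u ↦ √r u'` as a linear map on `H2 m`. -/
def derivMapOn (m : ℤ) : H2 m →ₗ[ℂ] L2 where
  toFun u := (memLp_sqrt_mul_deriv u.2).toLp _
  map_add' u v := by
    rw [← MemLp.toLp_add, MemLp.toLp_eq_toLp_iff]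
    filter_upwards [ae_restrict_mem measurableSet_Ioo] with r hr
    simp only [Pi.add_apply, Submodule.coe_add, deriv_add_on u.2 v.2 hr]
    ring
  map_smul' c u := by
    rw [RingHom.id_apply, ← MemLp.toLp_const_smul, MemLp.toLp_eq_toLp_iff]
    filter_upwards [ae_restrict_mem measurableSet_Ioo] with r hr
    simp only [Pi.smul_apply, Submodule.coe_smul, deriv_smul_on c u.2 hr, smul_eq_mul]
    ring

/-- `u ↦ |m| u / √r` as a linear map on `H2 m`. -/
def valueMapOn (m : ℤ) : H2 m →ₗ[ℂ] L2 where
  toFun u := (memLp_natAbs_div_sqrt_mul u.2).toLp _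
  map_add' u v := by
    rw [← MemLp.toLp_add, MemLp.toLp_eq_toLp_iff]
    refine Eventually.of_forall fun r => ?_
    simp only [Pi.add_apply, Submodule.coe_add]
    ring
  map_smul' c u := by
    rw [RingHom.id_apply, ← MemLp.toLp_const_smul, MemLp.toLp_eq_toLp_iff]
    refine Eventually.of_forall fun r => ?_
    simp only [Pi.smul_apply, Submodule.coe_smul, smul_eq_mul]
    ring

/-- A linear extension to all functions of `u ↦ (√r u', |m| u / √r)` on `H2 m`. -/
def gradMap (m : ℤ) : (ℝ → ℂ) →ₗ[ℂ] WithLp 2 (L2 × L2) :=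
  (LinearMap.exists_extend ((WithLp.linearEquiv 2 ℂ (L2 × L2)).symm.toLinearMap ∘ₗ
    (derivMapOn m).prod (valueMapOn m))).choose

theorem gradMap_apply (hu : MemH2 m u) :
    gradMap m u = WithLp.toLp 2 ((memLp_sqrt_mul_deriv hu).toLp _,
      (memLp_natAbs_div_sqrt_mul hu).toLp _) :=
  LinearMap.congr_fun (LinearMap.exists_extend ((WithLp.linearEquiv 2 ℂ (L2 × L2)).symm.toLinearMap
    ∘ₗ (derivMapOn m).prod (valueMapOn m))).choose_spec ⟨u, hu⟩

/-- The arguments are swapped because the form is conjugate-linear in its second argument and the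
inner product in its first. -/
theorem formA_eq_inner (hu : MemH2 m u) (hv : MemH2 m v) :
    formA m u v = inner ℂ (energyMap m v) (energyMap m u) := by
  rw [energyMap_apply hu, energyMap_apply hv, inner_toLp, formA]
  refine setIntegral_congr_fun measurableSet_Ioo fun r hr => ?_
  have hs : ((√r : ℝ) : ℂ) * ((√r : ℝ) : ℂ) = r := by
    exact_mod_cast Real.mul_self_sqrt hr.1.le
  simp only [weightedLaplacian, map_mul, Complex.conj_ofReal]
  linear_combination - radialLaplacian m u r * conj (radialLaplacian m v r) * hs

theorem formB_eq_inner (hu : MemH2 m u) (hv : MemH2 m v) :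
    formB m u v = inner ℂ (gradMap m v) (gradMap m u) := by
  rw [gradMap_apply hu, gradMap_apply hv, WithLp.prod_inner_apply, inner_toLp, inner_toLp,
    ← integral_add, formB]
  · refine setIntegral_congr_fun measurableSet_Ioo fun r hr => ?_
    have hs : ((√r : ℝ) : ℂ) * ((√r : ℝ) : ℂ) = r := by
      exact_mod_cast Real.mul_self_sqrt hr.1.le
    have hrc : ((√r : ℝ) : ℂ) ≠ 0 := by exact_mod_cast (Real.sqrt_pos.2 hr.1).ne'
    simp only [map_mul, map_div₀, Complex.conj_ofReal, intCast_sq_eq, Complex.conj_natCast]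
    rw [← hs]
    field_simp
  · exact (memLp_sqrt_mul_deriv hv).star.integrable_mul (memLp_sqrt_mul_deriv hu)
  · exact (memLp_natAbs_div_sqrt_mul hv).star.integrable_mul (memLp_natAbs_div_sqrt_mul hu)

/-- The component $\sqrt r\,u'$ suffices, also for $m=0$: a constant $u$ with $u(1)=0$ vanishes. -/
theorem eq_zero_of_gradMap_eq_zero (hu : MemH2 m u) (h0 : gradMap m u = 0) : u = 0 := by
  rw [gradMap_apply hu] at h0
  have h1 : (memLp_sqrt_mul_deriv hu).toLp _ = 0 :=
    congrArg Prod.fst (congrArg WithLp.ofLp h0)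
  have h2 : ∀ᵐ r ∂(volume.restrict (Ioo (0 : ℝ) 1)), deriv u r = 0 := by
    have h3 := (memLp_sqrt_mul_deriv hu).coeFn_toLp
    rw [h1] at h3
    filter_upwards [h3, Lp.coeFn_zero ℂ 2 (volume.restrict (Ioo (0 : ℝ) 1)),
      ae_restrict_mem measurableSet_Ioo] with r h4 h5 hr
    rw [h5, Pi.zero_apply] at h4
    have hs : ((√r : ℝ) : ℂ) ≠ 0 := by exact_mod_cast (Real.sqrt_pos.2 hr.1).ne'
    exact (mul_eq_zero.1 h4.symm).resolve_left hs
  have h3 : EqOn (deriv u) (fun _ => 0) (Ioo 0 1) :=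
    Measure.eqOn_open_of_ae_eq h2 isOpen_Ioo hu.continuousOn_deriv continuousOn_const
  have h4 : ∀ x ∈ Ioo (0 : ℝ) 1, ∀ y ∈ Ioo (0 : ℝ) 1, u x = u y := fun x hx y hy =>
    isOpen_Ioo.is_const_of_deriv_eq_zero isPreconnected_Ioo hu.differentiableOn h3 hx hy
  funext r
  by_cases hr : r ∈ Ioo (0 : ℝ) 1
  · refine tendsto_nhds_unique (tendsto_const_nhds.congr' ?_) hu.boundary_value
    filter_upwards [eventually_mem_left] with y hy using h4 r hr y hy
  · exact hu.eq_zero_outside r hr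

/-- The image is exactly the orthogonal complement of $r^{|m|}\sqrt r$: one inclusion is
`moment_one_eq_zero`, the other is solvability through `radialSolution`. This makes $H_m$ complete
in the energy norm. -/
theorem isClosed_map_energyMap (m : ℤ) : IsClosed ((H2 m).map (energyMap m) : Set L2) := by
  have hq : MemLp (fun r : ℝ => ((r ^ m.natAbs * √r : ℝ) : ℂ)) 2 (volume.restrict (Ioo 0 1)) := by
    refine MemLp.of_bound (Continuous.aestronglyMeasurable (by fun_prop)) 1 ?_
    filter_upwards [ae_restrict_mem measurableSet_Ioo] with r hr
    have hr0 := hr.1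
    rw [Complex.norm_real, Real.norm_of_nonneg (by positivity)]
    exact mul_le_one₀ (pow_le_one₀ hr0.le hr.2.le) (Real.sqrt_nonneg _) (Real.sqrt_le_one.2 hr.2.le)
  have hset : ((H2 m).map (energyMap m) : Set L2) = {f | inner ℂ (hq.toLp _) f = 0} := by
    ext f
    constructor
    · rintro ⟨u, hu, rfl⟩
      rw [mem_ofPred_eq, energyMap_apply hu,
        ← moment_one_eq_inner m.natAbs hq (fun _ => rfl) (memLp_weightedLaplacian hu)]
      exact moment_one_eq_zero hu
    · intro hf
      have hfL := Lp.memLp f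
      have h1 : moment m.natAbs f 1 = 0 := by
        rw [moment_one_eq_inner m.natAbs hq (fun _ => rfl) hfL, Lp.toLp_coeFn]
        exact hf
      have hu := memH2_radialSolution hfL h1
      refine ⟨_, hu, ?_⟩
      rw [energyMap_apply hu]
      refine Eq.trans ?_ (Lp.toLp_coeFn f hfL)
      rw [MemLp.toLp_eq_toLp_iff, EventuallyEq, ae_restrict_iff' measurableSet_Ioo]
      exact weightedLaplacian_radialSolution m hfL
  rw [hset]
  exact isClosed_eq (by fun_prop) continuous_const

/-- Bessel's inequality for the evaluation functionals at a fixed $r$, with constants independent of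
$r$, is integrated over an interval of length one. -/
theorem sum_norm_sq_gradMap_le {n : ℕ} {e : Fin n → ℝ → ℂ} (he : ∀ i, MemH2 m (e i))
    (ho : Orthonormal ℂ fun i => energyMap m (e i)) :
    ∑ i, ‖gradMap m (e i)‖ ^ 2 ≤ (1 + 2 * m.natAbs : ℝ) ^ 2 + (2 * m.natAbs : ℝ) ^ 2 := by
  -- The value $0$ outside $(0,1)$ keeps the functional linear, since additivity of the derivative
  -- is known only inside.
  let φ : ℝ → H2 m →ₗ[ℂ] ℂ := fun r =>
    { toFun := fun u => (√r : ℂ) * if r ∈ Ioo (0 : ℝ) 1 then deriv u r else 0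
      map_add' := fun u v => by
        split_ifs with hr
        · rw [Submodule.coe_add, deriv_add_on u.2 v.2 hr, Pi.add_apply, mul_add]
        · simp
      map_smul' := fun c u => by
        split_ifs with hr
        · rw [Submodule.coe_smul, deriv_smul_on c u.2 hr, Pi.smul_apply, smul_eq_mul, smul_eq_mul,
            RingHom.id_apply]
          ring
        · simp }
  let χ : ℝ → H2 m →ₗ[ℂ] ℂ := fun r =>
    { toFun := fun u => (m.natAbs : ℂ) / (√r : ℂ) * (u : ℝ → ℂ) r
      map_add' := fun u v => by rw [Submodule.coe_add, Pi.add_apply, mul_add]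
      map_smul' := fun c u => by
        rw [Submodule.coe_smul, Pi.smul_apply, smul_eq_mul, smul_eq_mul, RingHom.id_apply]
        ring }
  let A := (energyMap m).domRestrict (H2 m)
  have h1 : ∀ r ∈ Ioo (0 : ℝ) 1, ∑ i, ‖(√r : ℂ) * deriv (e i) r‖ ^ 2
      ≤ (1 + 2 * m.natAbs : ℝ) ^ 2 := by
    intro r hr
    have := sum_norm_sq_le A (φ r) (C := 1 + 2 * m.natAbs) (fun u => ?_)
      (fun i => (⟨e i, he i⟩ : H2 m)) ho
    · simpa only [φ, LinearMap.coe_mk, AddHom.coe_mk, if_pos hr] using this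
    · simp only [φ, LinearMap.coe_mk, AddHom.coe_mk, if_pos hr]
      exact norm_sqrt_mul_deriv_le u.2 hr
  have h2 : ∀ r ∈ Ioo (0 : ℝ) 1, ∑ i, ‖(m.natAbs : ℂ) / (√r : ℂ) * e i r‖ ^ 2
      ≤ (2 * m.natAbs : ℝ) ^ 2 := fun r hr =>
    sum_norm_sq_le A (χ r) (C := 2 * m.natAbs) (fun u => norm_natAbs_div_sqrt_mul_le u.2 hr)
      (fun i => (⟨e i, he i⟩ : H2 m)) ho
  have h3 := sum_norm_sq_toLp_le (fun i => memLp_sqrt_mul_deriv (he i)) h1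
  have h4 := sum_norm_sq_toLp_le (fun i => memLp_natAbs_div_sqrt_mul (he i)) h2
  refine le_trans (le_of_eq ?_) (add_le_add h3 h4)
  rw [← Finset.sum_add_distrib]
  refine Finset.sum_congr rfl fun i _ => ?_
  rw [gradMap_apply (he i), WithLp.prod_norm_sq_eq_of_L2]
  rfl

theorem norm_gradMap_sq_le (hu : MemH2 m u) :
    ‖gradMap m u‖ ^ 2
      ≤ ((1 + 2 * m.natAbs : ℝ) ^ 2 + (2 * m.natAbs : ℝ) ^ 2) * ‖energyMap m u‖ ^ 2 := by
  have h1 := sum_norm_sq_toLp_le (n := 1) (fun _ => memLp_sqrt_mul_deriv hu)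
    (C := ((1 + 2 * m.natAbs) * ‖energyMap m u‖) ^ 2) fun r hr => by
      simpa using pow_le_pow_left₀ (norm_nonneg _) (norm_sqrt_mul_deriv_le hu hr) 2
  have h2 := sum_norm_sq_toLp_le (n := 1) (fun _ => memLp_natAbs_div_sqrt_mul hu)
    (C := (2 * m.natAbs * ‖energyMap m u‖) ^ 2) fun r hr => by
      simpa using pow_le_pow_left₀ (norm_nonneg _) (norm_natAbs_div_sqrt_mul_le hu hr) 2
  rw [Fin.sum_univ_one] at h1 h2
  rw [gradMap_apply hu, WithLp.prod_norm_sq_eq_of_L2]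
  exact (add_le_add h1 h2).trans_eq (by ring)

theorem eq_zero_of_energyMap_eq_zero (hu : MemH2 m u) (h0 : energyMap m u = 0) : u = 0 := by
  refine eq_zero_of_gradMap_eq_zero hu ?_
  have := norm_gradMap_sq_le hu
  rw [h0, norm_zero, zero_pow two_ne_zero, mul_zero] at this
  exact norm_eq_zero.1 (pow_eq_zero_iff two_ne_zero |>.1 (le_antisymm this (by positivity)))

end Realization

/-! ### Spectral theory of the eigenvalue problem on a subspace, and the min-max principle. -/

section Spectral

variable {m : ℤ} {V : Submodule ℂ (ℝ → ℂ)}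

theorem formB_self {u : ℝ → ℂ} (hu : MemH2 m u) :
    formB m u u = ((‖gradMap m u‖ ^ 2 : ℝ) : ℂ) := by
  rw [formB_eq_inner hu hu, inner_self_eq_norm_sq_to_K]
  push_cast
  rfl

theorem formB_self_re {u : ℝ → ℂ} (hu : MemH2 m u) :
    (formB m u u).re = ‖gradMap m u‖ ^ 2 := by
  rw [formB_self hu, Complex.ofReal_re]

theorem isEigenpair_iff (hV : V ≤ H2 m) {ν : ℝ} {ψ : ℝ → ℂ} :
    IsEigenpair m V ν ψ ↔ ψ ∈ V ∧ ‖gradMap m ψ‖ = 1 ∧ ∀ v ∈ V,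
      inner ℂ (energyMap m v) (energyMap m ψ)
        = (ν : ℂ) * inner ℂ (gradMap m v) (gradMap m ψ) := by
  refine and_congr_right fun hψ => and_congr ?_ (forall₂_congr fun v hv => ?_)
  · rw [formB_self (hV hψ), ← Complex.ofReal_one, Complex.ofReal_inj]
    exact pow_eq_one_iff_of_nonneg (norm_nonneg _) two_ne_zero
  · rw [formA_eq_inner (hV hψ) (hV hv), formB_eq_inner (hV hψ) (hV hv)]

theorem IsEigenpair.norm_energyMap_sq (hV : V ≤ H2 m) {ν : ℝ} {ψ : ℝ → ℂ}
    (h : IsEigenpair m V ν ψ) : ‖energyMap m ψ‖ ^ 2 = ν := by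
  obtain ⟨h1, h2, h3⟩ := (isEigenpair_iff hV).1 h
  have h4 := h3 ψ h1
  rw [inner_self_eq_norm_sq_to_K, inner_self_eq_norm_sq_to_K, h2] at h4
  simp only [Complex.coe_algebraMap, Complex.ofReal_one, one_pow, mul_one] at h4
  exact_mod_cast h4

theorem IsEigenpair.pos (hV : V ≤ H2 m) {ν : ℝ} {ψ : ℝ → ℂ} (h : IsEigenpair m V ν ψ) :
    0 < ν := by
  rw [← h.norm_energyMap_sq hV]
  obtain ⟨h1, h2, -⟩ := (isEigenpair_iff hV).1 h
  refine pow_pos (norm_pos_iff.2 fun h0 => ?_) 2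
  rw [eq_zero_of_energyMap_eq_zero (hV h1) h0, map_zero, norm_zero] at h2
  exact zero_ne_one h2

/-- Spectral gap for the eigenvalue problem on a subspace that is complete in the energy norm. -/
theorem exists_gap (hV : V ≤ H2 m) (hc : IsClosed (V.map (energyMap m) : Set L2)) (lam : ℝ) :
    ∃ ν > lam, ∀ v ∈ V, (∀ ν' ≤ lam, ∀ ψ, IsEigenpair m V ν' ψ →
      inner ℂ (energyMap m ψ) (energyMap m v) = 0) →
      ν * ‖gradMap m v‖ ^ 2 ≤ ‖energyMap m v‖ ^ 2 := by
  let A : V →ₗ[ℂ] L2 := (energyMap m).domRestrict V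
  have hA : Function.Injective A := by
    rw [injective_iff_map_eq_zero]
    intro v hv
    exact Subtype.ext (eq_zero_of_energyMap_eq_zero (hV v.2) hv)
  have hrange : (LinearMap.range A : Set L2) = (V.map (energyMap m) : Set L2) := by
    rw [LinearMap.range_domRestrict]
  -- The abstract gap theorem is applied on the energy image of $V$, which is a Hilbert space
  -- because it is closed in $L^2$.
  have : CompleteSpace (LinearMap.range A) := by
    have : IsClosed (LinearMap.range A : Set L2) := hrange ▸ hc
    exact this.completeSpace_coe
  let e : V ≃ₗ[ℂ] LinearMap.range A := LinearEquiv.ofInjective A hA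
  have he : ∀ x : LinearMap.range A, energyMap m (e.symm x : ℝ → ℂ) = x := fun x =>
    congrArg Subtype.val (e.apply_symm_apply x)
  let S₀ : LinearMap.range A →ₗ[ℂ] WithLp 2 (L2 × L2) :=
    (gradMap m).domRestrict V ∘ₗ e.symm.toLinearMap
  have hS₀ : ∀ x, S₀ x = gradMap m (e.symm x : ℝ → ℂ) := fun x => rfl
  set D : ℝ := (1 + 2 * m.natAbs : ℝ) ^ 2 + (2 * m.natAbs : ℝ) ^ 2 with hD
  let S : LinearMap.range A →L[ℂ] WithLp 2 (L2 × L2) := S₀.mkContinuous √D fun x => by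
    refine le_of_sq_le_sq ?_ (by positivity)
    rw [mul_pow, Real.sq_sqrt (by positivity), hS₀, Submodule.coe_norm, ← he x]
    exact norm_gradMap_sq_le (hV (e.symm x).2)
  have hS : ∀ x, S x = gradMap m (e.symm x : ℝ → ℂ) := fun x => rfl
  have hcomp : IsCompactOperator S := by
    refine isCompactOperator_of_sum_le S D fun n x hx => ?_
    simp only [hS]
    refine sum_norm_sq_gradMap_le (fun i => hV (e.symm (x i)).2) ?_
    simp only [he]
    exact hx.comp_linearIsometry (LinearMap.range A).subtypeₗᵢ
  obtain ⟨ν, hν, hgap⟩ := exists_gap_of_isCompactOperator S hcomp lam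
  refine ⟨ν, hν, fun v hv hort => ?_⟩
  have hev : (e.symm (e ⟨v, hv⟩) : ℝ → ℂ) = v := by rw [e.symm_apply_apply]
  have := hgap (e ⟨v, hv⟩) fun x ν' hν' hx => ?_
  · rw [hS, hev] at this
    exact this
  · change inner ℂ (x : L2) (energyMap m v) = 0
    set ψ : ℝ → ℂ := Subtype.val (e.symm x)
    have hψV : ψ ∈ V := (e.symm x).2
    have hxψ : (x : L2) = energyMap m ψ := (he x).symm
    by_cases h0 : gradMap m ψ = 0
    · rw [hxψ, eq_zero_of_gradMap_eq_zero (hV hψV) h0, map_zero, inner_zero_left]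
    have h0' : (‖gradMap m ψ‖ : ℂ) ≠ 0 := by simpa using h0
    -- Eigenpairs are normalized in $\mathcal B_m$, so the abstract eigenvector has to be rescaled
    -- first.
    have hpair : IsEigenpair m V ν' ((‖gradMap m ψ‖ : ℂ)⁻¹ • ψ) := by
      rw [isEigenpair_iff hV]
      refine ⟨V.smul_mem _ hψV, ?_, fun w hw => ?_⟩
      · rw [map_smul]
        exact norm_smul_inv_norm h0
      · have h1 := hx (e ⟨w, hw⟩)
        have hew : (e.symm (e ⟨w, hw⟩) : ℝ → ℂ) = w := by rw [e.symm_apply_apply]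
        rw [hS, hS, hew] at h1
        have h2 : inner ℂ (energyMap m w) (x : L2)
            = (ν' : ℂ) * inner ℂ (gradMap m w) (gradMap m ψ) := h1
        rw [hxψ] at h2
        rw [map_smul, map_smul, inner_smul_right, inner_smul_right, h2]
        ring
    have h1 := hort ν' hν' _ hpair
    rw [map_smul, inner_smul_left] at h1
    rw [hxψ]
    exact (mul_eq_zero.1 h1).resolve_left (by simpa using h0)

/-- The span of the eigenfunctions with eigenvalue at most `μ`. -/
def eigenSpan (m : ℤ) (V : Submodule ℂ (ℝ → ℂ)) (μ : ℝ) : Submodule ℂ (ℝ → ℂ) :=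
  Submodule.span ℂ {ψ : ℝ → ℂ | ∃ ν ≤ μ, IsEigenpair m V ν ψ}

/-- The set whose infimum is the `l`-th eigenvalue. -/
def spectralSet (m : ℤ) (V : Submodule ℂ (ℝ → ℂ)) (l : ℕ) : Set ℝ :=
  {μ : ℝ | (l : Cardinal) ≤ Module.rank ℂ (eigenSpan m V μ)}

theorem mem_spectralSet {l : ℕ} {μ : ℝ} :
    μ ∈ spectralSet m V l ↔ (l : Cardinal) ≤ Module.rank ℂ (eigenSpan m V μ) := Iff.rfl

theorem IsEigenpair.mem_eigenSpan {ν μ : ℝ} {ψ : ℝ → ℂ} (h : IsEigenpair m V ν ψ) (hν : ν ≤ μ) :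
    ψ ∈ eigenSpan m V μ := Submodule.subset_span ⟨ν, hν, h⟩

theorem eigenSpan_le (m : ℤ) (V : Submodule ℂ (ℝ → ℂ)) (μ : ℝ) : eigenSpan m V μ ≤ V :=
  Submodule.span_le.2 fun _ ⟨_, _, h⟩ => h.1

theorem spectralSet_anti (m : ℤ) (V : Submodule ℂ (ℝ → ℂ)) {l l' : ℕ} (h : l ≤ l') :
    spectralSet m V l' ⊆ spectralSet m V l := fun _ hμ =>
  mem_spectralSet.2 (le_trans (Nat.cast_le.2 h) (mem_spectralSet.1 hμ))

theorem pos_of_mem_spectralSet (hV : V ≤ H2 m) {l : ℕ} (hl : 1 ≤ l) {μ : ℝ}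
    (hμ : μ ∈ spectralSet m V l) : 0 < μ := by
  by_contra hneg
  have hbot : eigenSpan m V μ = ⊥ := by
    rw [eigenSpan, Submodule.span_eq_bot]
    rintro ψ ⟨ν, hν, h⟩
    exact absurd (h.pos hV) (by linarith)
  have h1 : (l : Cardinal) ≤ 0 := by
    have h2 : (l : Cardinal) ≤ Module.rank ℂ (eigenSpan m V μ) := hμ
    rwa [hbot, rank_bot] at h2
  have h2 : l ≤ 0 := by exact_mod_cast h1
  omega

theorem bddBelow_spectralSet (hV : V ≤ H2 m) {l : ℕ} (hl : 1 ≤ l) :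
    BddBelow (spectralSet m V l) := ⟨0, fun _ hμ => (pos_of_mem_spectralSet hV hl hμ).le⟩

theorem eigenvalue_mono (hV : V ≤ H2 m) {l l' : ℕ} (hl : 1 ≤ l) (h : l ≤ l')
    (hne : (spectralSet m V l').Nonempty) : eigenvalue m V l ≤ eigenvalue m V l' :=
  csInf_le_csInf (bddBelow_spectralSet hV hl) hne (spectralSet_anti m V h)

theorem inner_gradMap_eq_zero (hV : V ≤ H2 m) {ν₁ ν₂ : ℝ} {ψ₁ ψ₂ : ℝ → ℂ}
    (h₁ : IsEigenpair m V ν₁ ψ₁) (h₂ : IsEigenpair m V ν₂ ψ₂) (hne : ν₁ ≠ ν₂) :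
    inner ℂ (gradMap m ψ₁) (gradMap m ψ₂) = 0 := by
  have a1 := ((isEigenpair_iff hV).1 h₁).2.2 ψ₂ h₂.1
  have a2 := ((isEigenpair_iff hV).1 h₂).2.2 ψ₁ h₁.1
  have a3 := congrArg conj a1
  rw [map_mul, inner_conj_symm, inner_conj_symm, Complex.conj_ofReal, a2] at a3
  have a4 : ((ν₂ : ℂ) - ν₁) * inner ℂ (gradMap m ψ₁) (gradMap m ψ₂) = 0 := by
    rw [sub_mul, a3, sub_self]
  refine (mul_eq_zero.1 a4).resolve_left (sub_ne_zero.2 ?_)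
  exact_mod_cast hne.symm

/-- On the span of the eigenfunctions with eigenvalue at most `μ`, the energy is at most `μ` times
the Dirichlet form. -/
theorem norm_energyMap_sq_le (hV : V ≤ H2 m) {μ : ℝ} {v : ℝ → ℂ} (hv : v ∈ eigenSpan m V μ) :
    ‖energyMap m v‖ ^ 2 ≤ μ * ‖gradMap m v‖ ^ 2 := by
  obtain ⟨n, f, g, rfl⟩ := Submodule.mem_span_set'.1 hv
  choose ν hν hg using fun i => (g i).2
  set v := ∑ i, f i • (g i : ℝ → ℂ) with hvdef
  -- A square-root trick: $\mu\mathcal B_m(v,v)-\mathcal A_m(v,v)=\mathcal B_m(w,w)\ge0$. Cross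
  -- terms between distinct eigenvalues vanish and those within one eigenvalue match, so no
  -- orthogonal basis of eigenfunctions has to be chosen.
  set w := ∑ i, ((√(μ - ν i) : ℂ) * f i) • (g i : ℝ → ℂ) with hw
  have key : (μ : ℂ) * inner ℂ (gradMap m v) (gradMap m v)
      - inner ℂ (energyMap m v) (energyMap m v) = inner ℂ (gradMap m w) (gradMap m w) := by
    simp only [hvdef, hw, map_sum, map_smul, sum_inner, inner_sum, inner_smul_left,
      inner_smul_right, Finset.mul_sum]
    simp only [← Finset.sum_sub_distrib]
    refine Finset.sum_congr rfl fun i _ => Finset.sum_congr rfl fun j _ => ?_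
    rw [((isEigenpair_iff hV).1 (hg i)).2.2 _ (hg j).1, map_mul, Complex.conj_ofReal]
    by_cases h : ν j = ν i
    · have hs : (√(μ - ν i) : ℂ) * (√(μ - ν i) : ℂ) = (μ : ℂ) - ν i := by
        rw [← Complex.ofReal_mul, Real.mul_self_sqrt (sub_nonneg.2 (hν i)), Complex.ofReal_sub]
      rw [h]
      linear_combination (- f i * conj (f j) *
        inner ℂ (gradMap m (g j)) (gradMap m (g i))) * hs
    · rw [inner_gradMap_eq_zero hV (hg j) (hg i) h]
      ring
  have h1 := congrArg Complex.re key
  rw [Complex.sub_re, Complex.re_ofReal_mul] at h1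
  have e1 : ∀ x : L2, (inner ℂ x x : ℂ).re = ‖x‖ ^ 2 := fun x => inner_self_eq_norm_sq (𝕜 := ℂ) x
  have e2 : ∀ x : WithLp 2 (L2 × L2), (inner ℂ x x : ℂ).re = ‖x‖ ^ 2 := fun x =>
    inner_self_eq_norm_sq (𝕜 := ℂ) x
  rw [e1, e2, e2] at h1
  have h2 : 0 ≤ ‖gradMap m w‖ ^ 2 := by positivity
  linarith

theorem inner_eq_zero_of_mem_orthogonal {μ : ℝ} {v : ℝ → ℂ}
    (hv : energyMap m v ∈ ((eigenSpan m V μ).map (energyMap m))ᗮ) :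
    ∀ ν' ≤ μ, ∀ ψ, IsEigenpair m V ν' ψ → inner ℂ (energyMap m ψ) (energyMap m v) = 0 :=
  fun _ hν' _ hψ => (Submodule.mem_orthogonal _ _).1 hv _
    (Submodule.mem_map_of_mem (hψ.mem_eigenSpan hν'))

theorem finite_eigenSpan {l : ℕ} {μ : ℝ} (h : μ ∉ spectralSet m V l) :
    FiniteDimensional ℂ (eigenSpan m V μ) :=
  Module.rank_lt_aleph0_iff.1 ((not_le.1 (mt mem_spectralSet.2 h)).trans (Cardinal.natCast_lt_aleph0))

theorem finrank_eigenSpan_lt {l : ℕ} {μ : ℝ} (h : μ ∉ spectralSet m V l) :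
    Module.finrank ℂ (eigenSpan m V μ) < l := by
  have := finite_eigenSpan h
  have h1 := not_le.1 (mt mem_spectralSet.2 h)
  rw [← Module.finrank_eq_rank] at h1
  exact_mod_cast h1

/-- Min-max principle: a subspace on which the energy is at most `μ` times the Dirichlet form has
dimension at most the number of eigenvalues that are at most `μ`. -/
theorem mem_spectralSet_of_le (hV : V ≤ H2 m) (hc : IsClosed (V.map (energyMap m) : Set L2))
    {W : Submodule ℂ (ℝ → ℂ)} [FiniteDimensional ℂ W] (hWV : W ≤ V) {μ : ℝ}
    (hW : ∀ w ∈ W, ‖energyMap m w‖ ^ 2 ≤ μ * ‖gradMap m w‖ ^ 2) :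
    μ ∈ spectralSet m V (Module.finrank ℂ W) := by
  by_contra hμ
  have hfin := finite_eigenSpan hμ
  have hlt := finrank_eigenSpan_lt hμ
  obtain ⟨ν, hν, hgap⟩ := exists_gap hV hc μ
  let U : Submodule ℂ L2 := (eigenSpan m V μ).map (energyMap m)
  have hU : Module.finrank ℂ U < Module.finrank ℂ W :=
    (Submodule.finrank_map_le _ _).trans_lt hlt
  -- If the eigenfunctions up to $\mu$ spanned too little, projection of $W$ onto them would have a
  -- kernel. A nonzero $w$ there satisfies $\nu\mathcal B_m\le\mathcal A_m\le\mu\mathcal B_m$ with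
  -- $\nu>\mu$, which is impossible.
  let f : W →ₗ[ℂ] U := U.orthogonalProjectionOnto.toLinearMap ∘ₗ (energyMap m).domRestrict W
  obtain ⟨w, hw, hw0⟩ := Submodule.exists_mem_ne_zero_of_ne_bot
    (LinearMap.ker_ne_bot_of_finrank_lt (f := f) hU)
  have hort : energyMap m w ∈ Uᗮ := Submodule.orthogonalProjectionOnto_eq_zero_iff.1 hw
  have h1 := hgap w (hWV w.2) (inner_eq_zero_of_mem_orthogonal hort)
  have h2 := hW w w.2
  have h3 : 0 < ‖gradMap m (w : ℝ → ℂ)‖ ^ 2 := by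
    refine pow_pos (norm_pos_iff.2 fun h => hw0 ?_) 2
    exact Subtype.ext (eq_zero_of_gradMap_eq_zero (hV (hWV w.2)) h)
  nlinarith

theorem isClosed_map_of_finiteDimensional [FiniteDimensional ℂ V] :
    IsClosed (V.map (energyMap m) : Set L2) :=
  Submodule.closed_of_finiteDimensional _

/-- On a finite-dimensional space the energy is dominated by the definite form $\mathcal B_m$, so
the whole space is a trial space. Nonemptiness keeps the infimum defining an eigenvalue from being
the default value $0$. -/
theorem spectralSet_finrank_nonempty (hV : V ≤ H2 m) [FiniteDimensional ℂ V] :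
    (spectralSet m V (Module.finrank ℂ V)).Nonempty := by
  let S : V →ₗ[ℂ] WithLp 2 (L2 × L2) := (gradMap m).domRestrict V
  have hS : Function.Injective S := by
    rw [injective_iff_map_eq_zero]
    intro v hv
    exact Subtype.ext (eq_zero_of_gradMap_eq_zero (hV v.2) hv)
  let e := LinearEquiv.ofInjective S hS
  let T := LinearMap.toContinuousLinearMap
    ((energyMap m).domRestrict V ∘ₗ e.symm.toLinearMap)
  refine ⟨‖T‖ ^ 2, mem_spectralSet_of_le hV isClosed_map_of_finiteDimensional le_rfl
    fun w hw => ?_⟩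
  have h1 := T.le_opNorm (e ⟨w, hw⟩)
  have h2 : T (e ⟨w, hw⟩) = energyMap m w := by
    change energyMap m (e.symm (e ⟨w, hw⟩) : ℝ → ℂ) = _
    rw [e.symm_apply_apply]
  have h3 : ‖e ⟨w, hw⟩‖ = ‖gradMap m w‖ := rfl
  rw [h2, h3] at h1
  rw [← mul_pow]
  exact pow_le_pow_left₀ (norm_nonneg _) h1 2

/-- The infimum is attained: by the gap there is a $\nu$ above it with no eigenvalue strictly
between, so the eigenfunction span for some $\mu<\nu$ in the set is already the span at the infimum.
-/
theorem eigenvalue_mem_spectralSet (hV : V ≤ H2 m)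
    (hc : IsClosed (V.map (energyMap m) : Set L2)) {l : ℕ}
    (hne : (spectralSet m V l).Nonempty) : eigenvalue m V l ∈ spectralSet m V l := by
  obtain ⟨ν, hν, hgap⟩ := exists_gap hV hc (eigenvalue m V l)
  obtain ⟨μ, hμ, hμν⟩ := exists_lt_of_csInf_lt hne hν
  refine mem_spectralSet.2 (le_trans (mem_spectralSet.1 hμ) (Submodule.rank_mono (Submodule.span_le.2 ?_)))
  rintro ψ ⟨ν₁, hν₁, hψ⟩
  by_cases h : ν₁ ≤ eigenvalue m V l
  · exact hψ.mem_eigenSpan h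
  exfalso
  have h1 := hgap ψ hψ.1 fun ν' hν' φ hφ => by
    rw [((isEigenpair_iff hV).1 hψ).2.2 φ hφ.1, inner_gradMap_eq_zero hV hφ hψ, mul_zero]
    intro h2
    exact h (h2 ▸ hν')
  rw [hψ.norm_energyMap_sq hV, ((isEigenpair_iff hV).1 hψ).2.1] at h1
  linarith

theorem eigenvalue_pos (hV : V ≤ H2 m) (hc : IsClosed (V.map (energyMap m) : Set L2)) {l : ℕ}
    (hl : 1 ≤ l) (hne : (spectralSet m V l).Nonempty) : 0 < eigenvalue m V l :=
  pos_of_mem_spectralSet hV hl (eigenvalue_mem_spectralSet hV hc hne)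

theorem notMem_spectralSet_of_lt (hV : V ≤ H2 m) {l : ℕ} (hl : 1 ≤ l) {μ : ℝ}
    (hμ : μ < eigenvalue m V l) : μ ∉ spectralSet m V l :=
  notMem_of_lt_csInf hμ (bddBelow_spectralSet hV hl)

theorem span_le_eigenSpan (hV : V ≤ H2 m) {l : ℕ} {ψ : Fin l → ℝ → ℂ}
    (hψ : ∀ i : Fin l, IsEigenpair m V (eigenvalue m V (i + 1)) (ψ i))
    (hne : (spectralSet m V l).Nonempty) :
    Submodule.span ℂ (Set.range ψ) ≤ eigenSpan m V (eigenvalue m V l) := by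
  rw [Submodule.span_le]
  rintro _ ⟨i, rfl⟩
  exact (hψ i).mem_eigenSpan (eigenvalue_mono hV (by omega) (by omega) hne)

/-- A dimension count: below the next eigenvalue the eigenfunction span has no room beyond the given
functions. Thus an eigenfunction outside their span cannot have a smaller eigenvalue, which is what
the construction of the next one needs. -/
theorem eigenSpan_le_span (hV : V ≤ H2 m) {l : ℕ} {ψ : Fin l → ℝ → ℂ}
    (hli : LinearIndependent ℂ ψ)
    (hψ : ∀ i : Fin l, IsEigenpair m V (eigenvalue m V (i + 1)) (ψ i))
    (hne : (spectralSet m V (l + 1)).Nonempty) {μ : ℝ} (hμ : μ < eigenvalue m V (l + 1)) :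
    eigenSpan m V μ ≤ Submodule.span ℂ (Set.range ψ) := by
  induction l with
  | zero =>
    have h1 := notMem_spectralSet_of_lt hV le_rfl hμ
    have := finite_eigenSpan h1
    have h2 := finrank_eigenSpan_lt h1
    rw [Submodule.finrank_eq_zero.1 (Nat.lt_one_iff.1 h2)]
    exact bot_le
  | succ l ih =>
    have hne' := hne.mono (spectralSet_anti m V (Nat.le_succ (l + 1)))
    by_cases h : μ < eigenvalue m V (l + 1)
    · refine (ih (ψ := fun i => ψ i.castSucc)
        (hli.comp _ (Fin.castSucc_injective l)) (fun i => ?_) hne' h).trans ?_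
      · simpa using hψ i.castSucc
      · refine Submodule.span_mono ?_
        rintro _ ⟨i, rfl⟩
        exact ⟨i.castSucc, rfl⟩
    -- Here all the given functions have eigenvalues at most $\mu$, so their span lies inside a
    -- space of no larger dimension and equals it.
    · have h1 := notMem_spectralSet_of_lt hV (by omega) hμ
      have := finite_eigenSpan h1
      have h2 := finrank_eigenSpan_lt h1
      have h3 : Submodule.span ℂ (Set.range ψ) ≤ eigenSpan m V μ := by
        rw [Submodule.span_le]
        rintro _ ⟨i, rfl⟩
        exact (hψ i).mem_eigenSpan
          ((eigenvalue_mono hV (by omega) (by omega) hne').trans (not_lt.1 h))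
      refine (Submodule.eq_of_le_of_finrank_le h3 ?_).ge
      rw [finrank_span_eq_card hli, Fintype.card_fin]
      omega

theorem exists_eigenfunctions (hV : V ≤ H2 m) (hc : IsClosed (V.map (energyMap m) : Set L2))
    {l : ℕ} (hne : (spectralSet m V l).Nonempty) :
    ∃ ψ : Fin l → ℝ → ℂ, LinearIndependent ℂ ψ ∧
      ∀ i : Fin l, IsEigenpair m V (eigenvalue m V (i + 1)) (ψ i) := by
  induction l with
  | zero => exact ⟨Fin.elim0, linearIndependent_empty_type, fun i => i.elim0⟩
  | succ l ih =>
    obtain ⟨ψ, hli, hψ⟩ := ih (hne.mono (spectralSet_anti m V l.le_succ))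
    have hmem := eigenvalue_mem_spectralSet hV hc hne
    obtain ⟨φ, ⟨ν, hν, hφ⟩, hφn⟩ : ∃ φ ∈ {ψ : ℝ → ℂ | ∃ ν ≤ eigenvalue m V (l + 1),
        IsEigenpair m V ν ψ}, φ ∉ Submodule.span ℂ (Set.range ψ) := by
      by_contra! hall
      have h1 : eigenSpan m V (eigenvalue m V (l + 1)) ≤ Submodule.span ℂ (Set.range ψ) :=
        Submodule.span_le.2 hall
      have h2 := le_trans (mem_spectralSet.1 hmem) (Submodule.rank_mono h1)
      have hf : FiniteDimensional ℂ (Submodule.span ℂ (Set.range ψ)) :=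
        FiniteDimensional.span_of_finite ℂ (Set.finite_range ψ)
      rw [← Module.finrank_eq_rank, finrank_span_eq_card hli, Fintype.card_fin] at h2
      have h3 : l + 1 ≤ l := by exact_mod_cast h2
      omega
    -- The new eigenfunction lies outside the span of the previous ones, so its eigenvalue cannot be
    -- strictly smaller.
    have hνeq : ν = eigenvalue m V (l + 1) := by
      refine le_antisymm hν (not_lt.1 fun hlt => hφn ?_)
      exact eigenSpan_le_span hV hli hψ hne hlt (hφ.mem_eigenSpan le_rfl)
    refine ⟨Fin.snoc ψ φ, linearIndependent_finSnoc.2 ⟨hli, hφn⟩, fun i => ?_⟩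
    induction i using Fin.lastCases with
    | last => simpa [← hνeq] using hφ
    | cast i => simpa using hψ i

end Spectral

/-! ### The Galerkin projection and the maximal quotient. -/

section Projection

variable {m : ℤ} {N : ℕ}

theorem galerkinSpace_le (m : ℤ) (N : ℕ) : galerkinSpace m N ≤ H2 m := inf_le_right

variable [FiniteDimensional ℂ (galerkinSpace m N)]

theorem galerkinProj_spec {u : ℝ → ℂ} (hu : MemH2 m u) :
    galerkinProj m N u ∈ galerkinSpace m N ∧
      ∀ v ∈ galerkinSpace m N, formA m (u - galerkinProj m N u) v = 0 := by
  have hex : ∃ w ∈ galerkinSpace m N, ∀ v ∈ galerkinSpace m N, formA m (u - w) v = 0 := by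
    let K : Submodule ℂ L2 := (galerkinSpace m N).map (energyMap m)
    obtain ⟨w, hw, hwK⟩ := K.starProjection_apply_mem (energyMap m u)
    refine ⟨w, hw, fun v hv => ?_⟩
    have hw' := galerkinSpace_le m N hw
    rw [formA_eq_inner ((H2 m).sub_mem hu hw') (galerkinSpace_le m N hv), map_sub, hwK]
    exact (Submodule.mem_orthogonal _ _).1 (K.sub_starProjection_mem_orthogonal _) _
      (Submodule.mem_map_of_mem hv)
  have h1 : galerkinProj m N u = hex.choose := dif_pos hex
  rw [h1]
  exact hex.choose_spec

/-- In $L^2$ the chosen element is the genuine orthogonal projection; with injectivity of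
`energyMap` this yields linearity and contractivity. -/
theorem energyMap_galerkinProj {u : ℝ → ℂ} (hu : MemH2 m u) :
    energyMap m (galerkinProj m N u)
      = ((galerkinSpace m N).map (energyMap m)).starProjection (energyMap m u) := by
  obtain ⟨h1, h2⟩ := galerkinProj_spec (N := N) hu
  refine (Submodule.eq_starProjection_of_mem_orthogonal (Submodule.mem_map_of_mem h1) ?_).symm
  rw [Submodule.mem_orthogonal]
  rintro _ ⟨v, hv, rfl⟩
  rw [← map_sub, ← formA_eq_inner ((H2 m).sub_mem hu (galerkinSpace_le m N h1))
    (galerkinSpace_le m N hv)]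
  exact h2 v hv

theorem galerkinProj_linearCombination {l : ℕ} {ψ : Fin l → ℝ → ℂ} (hψ : ∀ i, MemH2 m (ψ i))
    (c : Fin l → ℂ) : galerkinProj m N (Fintype.linearCombination ℂ ψ c)
      = Fintype.linearCombination ℂ (fun i => galerkinProj m N (ψ i)) c := by
  have hsum : MemH2 m (Fintype.linearCombination ℂ ψ c) := by
    rw [Fintype.linearCombination_apply]
    exact (H2 m).sum_mem fun i _ => (H2 m).smul_mem _ (hψ i)
  have h1 := galerkinSpace_le m N (galerkinProj_spec (N := N) hsum).1
  have h2 : Fintype.linearCombination ℂ (fun i => galerkinProj m N (ψ i)) c ∈ H2 m := by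
    rw [Fintype.linearCombination_apply]
    exact (H2 m).sum_mem fun i _ =>
      (H2 m).smul_mem _ (galerkinSpace_le m N (galerkinProj_spec (hψ i)).1)
  rw [← sub_eq_zero]
  refine eq_zero_of_energyMap_eq_zero ((H2 m).sub_mem h1 h2) ?_
  rw [map_sub, energyMap_galerkinProj hsum, sub_eq_zero]
  simp only [Fintype.linearCombination_apply, map_sum, map_smul, energyMap_galerkinProj (hψ _)]

theorem norm_energyMap_galerkinProj_le {u : ℝ → ℂ} (hu : MemH2 m u) :
    ‖energyMap m (galerkinProj m N u)‖ ≤ ‖energyMap m u‖ := by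
  rw [energyMap_galerkinProj hu]
  exact Submodule.norm_starProjection_apply_le _ _

theorem projRatio_eq {u : ℝ → ℂ} (hu : MemH2 m u) :
    projRatio m N u = ENNReal.ofReal (‖gradMap m u‖ ^ 2) /
      ENNReal.ofReal (‖gradMap m (galerkinProj m N u)‖ ^ 2) := by
  rw [projRatio, formB_self_re hu,
    formB_self_re (galerkinSpace_le m N (galerkinProj_spec hu).1)]

theorem norm_gradMap_sq_pos {u : ℝ → ℂ} (hu : MemH2 m u) (h0 : u ≠ 0) :
    0 < ‖gradMap m u‖ ^ 2 :=
  pow_pos (norm_pos_iff.2 fun h => h0 (eq_zero_of_gradMap_eq_zero hu h)) 2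

/-- If the Galerkin projection is injective on the span of `ψ`, the quotient of Dirichlet forms
attains its maximum there. -/
theorem exists_max_ratio {l : ℕ} (hl : 1 ≤ l) {ψ : Fin l → ℝ → ℂ} (hψ : ∀ i, MemH2 m (ψ i))
    (hli : LinearIndependent ℂ ψ)
    (hinj : ∀ v ∈ Submodule.span ℂ (Set.range ψ), v ≠ 0 → galerkinProj m N v ≠ 0) :
    ∃ v₀ ∈ Submodule.span ℂ (Set.range ψ), v₀ ≠ 0 ∧
      ∀ v ∈ Submodule.span ℂ (Set.range ψ), v ≠ 0 →
        ‖gradMap m v‖ ^ 2 / ‖gradMap m (galerkinProj m N v)‖ ^ 2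
          ≤ ‖gradMap m v₀‖ ^ 2 / ‖gradMap m (galerkinProj m N v₀)‖ ^ 2 := by
  set L := Fintype.linearCombination ℂ ψ with hL
  set L' := Fintype.linearCombination ℂ (fun i => galerkinProj m N (ψ i)) with hL'
  have hspan : ∀ c, L c ∈ Submodule.span ℂ (Set.range ψ) := fun c => by
    rw [← Fintype.range_linearCombination ℂ ψ]
    exact ⟨c, rfl⟩
  have hH2 : Submodule.span ℂ (Set.range ψ) ≤ H2 m := by
    rw [Submodule.span_le]
    rintro _ ⟨i, rfl⟩
    exact hψ i
  have hproj : ∀ c, galerkinProj m N (L c) = L' c := galerkinProj_linearCombination hψ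
  have hne : ∀ c, c ≠ 0 → L c ≠ 0 := fun c hc h => hc
    (linearIndependent_iff_injective_fintypeLinearCombination.1 hli (by rw [← hL, h, map_zero]))
  have hpos : ∀ c, c ≠ 0 → 0 < ‖gradMap m (L' c)‖ ^ 2 := fun c hc => by
    rw [← hproj]
    exact norm_gradMap_sq_pos (galerkinSpace_le m N (galerkinProj_spec (hH2 (hspan c))).1)
      (hinj _ (hspan c) (hne c hc))
  -- The quotient is homogeneous of degree zero in the coefficients, so it is maximized on their
  -- compact unit sphere, where injectivity of the projection keeps the denominator positive.
  let F : (Fin l → ℂ) → ℝ := fun c => ‖gradMap m (L c)‖ ^ 2 / ‖gradMap m (L' c)‖ ^ 2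
  have hF : ContinuousOn F (Metric.sphere 0 1) := by
    have c1 : Continuous fun c => gradMap m (L c) :=
      (gradMap m ∘ₗ L).continuous_of_finiteDimensional
    have c2 : Continuous fun c => gradMap m (L' c) :=
      (gradMap m ∘ₗ L').continuous_of_finiteDimensional
    refine ((c1.norm.pow 2).continuousOn).div ((c2.norm.pow 2).continuousOn) fun c hc => ?_
    exact (hpos c (ne_zero_of_mem_unit_sphere ⟨c, hc⟩)).ne'
  have : NeZero l := ⟨by omega⟩
  obtain ⟨c₀, hc₀, hmax⟩ := (isCompact_sphere (0 : Fin l → ℂ) 1).exists_isMaxOn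
    ((NormedSpace.sphere_nonempty).2 zero_le_one) hF
  refine ⟨L c₀, hspan c₀, hne c₀ (ne_zero_of_mem_unit_sphere ⟨c₀, hc₀⟩), fun v hv hv0 => ?_⟩
  rw [← Fintype.range_linearCombination ℂ ψ] at hv
  obtain ⟨c, rfl⟩ := hv
  have hc0 : c ≠ 0 := by
    rintro rfl
    exact hv0 (map_zero _)
  have hcn : ((‖c‖ : ℂ))⁻¹ ≠ 0 := by simpa using hc0
  have h1 : (‖c‖ : ℂ)⁻¹ • c ∈ Metric.sphere (0 : Fin l → ℂ) 1 := by
    rw [mem_sphere_zero_iff_norm]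
    exact norm_smul_inv_norm hc0
  have h2 : F ((‖c‖ : ℂ)⁻¹ • c) ≤ F c₀ := hmax h1
  have h3 : F ((‖c‖ : ℂ)⁻¹ • c) = F c := by
    simp only [F, map_smul, norm_smul, mul_pow]
    exact mul_div_mul_left _ _ (pow_ne_zero 2 (norm_ne_zero_iff.2 hcn))
  rw [h3] at h2
  rw [hproj c₀, ← hL, hproj c]
  exact h2

end Projection

end StokesDisk

end

/-! ### The two-sided eigenvalue estimate. -/

theorem mainTheorem4 (m : ℤ) (N l : ℕ) (hl : 1 ≤ l)
    (hlN : l ≤ Module.finrank ℂ (StokesDisk.galerkinSpace m N)) :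
    0 < StokesDisk.eigenvalue m (StokesDisk.H2 m) l ∧
    StokesDisk.eigenvalue m (StokesDisk.H2 m) l ≤
      StokesDisk.eigenvalue m (StokesDisk.galerkinSpace m N) l ∧
    (∃ ψ : Fin l → ℝ → ℂ, StokesDisk.AreFirstEigenfunctions m l ψ) ∧
    ∀ ψ : Fin l → ℝ → ℂ, StokesDisk.AreFirstEigenfunctions m l ψ →
      ∃ M : ℝ≥0∞,
        IsGreatest (StokesDisk.projRatio m N ''
          {v | v ∈ Submodule.span ℂ (Set.range ψ) ∧ v ≠ 0}) M ∧
        ENNReal.ofReal (StokesDisk.eigenvalue m (StokesDisk.galerkinSpace m N) l) ≤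
          ENNReal.ofReal (StokesDisk.eigenvalue m (StokesDisk.H2 m) l) * M := by
  open StokesDisk in
  -- `finrank` would be $0$ for an infinite-dimensional space, so $1\le l\le$ `finrank` already
  -- gives finite dimension.
  have hfin : FiniteDimensional ℂ (galerkinSpace m N) := Module.finite_of_finrank_pos (by omega)
  have hX := galerkinSpace_le m N
  have hcH := isClosed_map_energyMap m
  have hcX : IsClosed ((galerkinSpace m N).map (energyMap m) : Set L2) :=
    isClosed_map_of_finiteDimensional
  have hneX : (spectralSet m (galerkinSpace m N) l).Nonempty :=
    (spectralSet_finrank_nonempty hX).mono (spectralSet_anti _ _ hlN)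
  -- The discrete eigenfunctions up to $\lambda_{mN}^l$ serve as trial functions in $H_m$.
  -- Multiplicity may make their span larger than $l$, whence the monotonicity in $l$.
  have hsub : eigenvalue m (galerkinSpace m N) l ∈ spectralSet m (H2 m) l := by
    have h1 := eigenvalue_mem_spectralSet hX hcX hneX
    have h2 : eigenSpan m (galerkinSpace m N) (eigenvalue m (galerkinSpace m N) l)
        ≤ galerkinSpace m N := eigenSpan_le _ _ _
    have : FiniteDimensional ℂ
        (eigenSpan m (galerkinSpace m N) (eigenvalue m (galerkinSpace m N) l)) :=
      Submodule.finiteDimensional_of_le h2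
    rw [mem_spectralSet, ← Module.finrank_eq_rank] at h1
    exact spectralSet_anti _ _ (Nat.cast_le.1 h1) (mem_spectralSet_of_le le_rfl hcH (h2.trans hX)
      fun w hw => norm_energyMap_sq_le hX hw)
  have hneH : (spectralSet m (H2 m) l).Nonempty := ⟨_, hsub⟩
  have hpos := eigenvalue_pos le_rfl hcH hl hneH
  refine ⟨hpos, csInf_le (bddBelow_spectralSet le_rfl hl) hsub,
    exists_eigenfunctions le_rfl hcH hneH, ?_⟩
  rintro ψ ⟨hli, hψ⟩
  have hψH : ∀ i, MemH2 m (ψ i) := fun i => (hψ i).1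
  have hspan := span_le_eigenSpan le_rfl hψ hneH
  have hH2 : Submodule.span ℂ (Set.range ψ) ≤ H2 m := hspan.trans (eigenSpan_le _ _ _)
  by_cases hinj : ∀ v ∈ Submodule.span ℂ (Set.range ψ), v ≠ 0 → galerkinProj m N v ≠ 0
  · obtain ⟨v₀, hv₀, hv₀0, hmax⟩ := exists_max_ratio hl hψH hli hinj
    have hden : ∀ v ∈ Submodule.span ℂ (Set.range ψ), v ≠ 0 →
        0 < ‖gradMap m (galerkinProj m N v)‖ ^ 2 := fun v hv hv0 =>
      norm_gradMap_sq_pos (hX (galerkinProj_spec (hH2 hv)).1) (hinj v hv hv0)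
    have hratio : ∀ v ∈ Submodule.span ℂ (Set.range ψ), v ≠ 0 → projRatio m N v =
        ENNReal.ofReal (‖gradMap m v‖ ^ 2 / ‖gradMap m (galerkinProj m N v)‖ ^ 2) :=
      fun v hv hv0 => by
        rw [projRatio_eq (hH2 hv), ENNReal.ofReal_div_of_pos (hden v hv hv0)]
    set M := ‖gradMap m v₀‖ ^ 2 / ‖gradMap m (galerkinProj m N v₀)‖ ^ 2 with hM
    refine ⟨ENNReal.ofReal M, ⟨⟨v₀, ⟨hv₀, hv₀0⟩, hratio v₀ hv₀ hv₀0⟩, ?_⟩, ?_⟩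
    · rintro _ ⟨v, ⟨hv, hv0⟩, rfl⟩
      rw [hratio v hv hv0]
      exact ENNReal.ofReal_le_ofReal (hmax v hv hv0)
    · rw [← ENNReal.ofReal_mul hpos.le]
      refine ENNReal.ofReal_le_ofReal (csInf_le (bddBelow_spectralSet hX hl) ?_)
      have hli' : LinearIndependent ℂ fun i => galerkinProj m N (ψ i) := by
        rw [linearIndependent_iff_injective_fintypeLinearCombination, injective_iff_map_eq_zero]
        intro c hc
        rw [← galerkinProj_linearCombination hψH] at hc
        by_contra hc0
        refine hinj _ ?_ (fun h => hc0 ?_) hc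
        · rw [← Fintype.range_linearCombination ℂ ψ]
          exact ⟨c, rfl⟩
        · exact linearIndependent_iff_injective_fintypeLinearCombination.1 hli
            (by rw [h, map_zero])
      have hfW : FiniteDimensional ℂ
          (Submodule.span ℂ (Set.range fun i => galerkinProj m N (ψ i))) :=
        FiniteDimensional.span_of_finite ℂ (Set.finite_range _)
      have hcard := finrank_span_eq_card hli'
      rw [Fintype.card_fin] at hcard
      have hWX : Submodule.span ℂ (Set.range fun i => galerkinProj m N (ψ i))
          ≤ galerkinSpace m N := by
        rw [Submodule.span_le]
        rintro _ ⟨i, rfl⟩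
        exact (galerkinProj_spec (hψH i)).1
      -- Min-max in the Galerkin space with trial space $\Pi E_{1,l}$, whose dimension is still $l$
      -- because $\Pi$ is injective on $E_{1,l}$.
      have key := mem_spectralSet_of_le hX hcX hWX (μ := eigenvalue m (H2 m) l * M) ?_
      · rwa [hcard] at key
      intro w hw
      rw [← Fintype.range_linearCombination ℂ] at hw
      obtain ⟨c, rfl⟩ := hw
      rw [← galerkinProj_linearCombination hψH]
      have hv : Fintype.linearCombination ℂ ψ c ∈ Submodule.span ℂ (Set.range ψ) := by
        rw [← Fintype.range_linearCombination ℂ ψ]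
        exact ⟨c, rfl⟩
      set v := Fintype.linearCombination ℂ ψ c
      by_cases hv0 : v = 0
      · have h0 : energyMap m (galerkinProj m N v) = 0 := by
          rw [energyMap_galerkinProj (hH2 hv), hv0, map_zero, map_zero]
        rw [h0, norm_zero, zero_pow two_ne_zero]
        positivity
      have h1 := hmax v hv hv0
      rw [div_le_iff₀ (hden v hv hv0)] at h1
      calc ‖energyMap m (galerkinProj m N v)‖ ^ 2 ≤ ‖energyMap m v‖ ^ 2 :=
            pow_le_pow_left₀ (norm_nonneg _) (norm_energyMap_galerkinProj_le (hH2 hv)) 2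
        _ ≤ eigenvalue m (H2 m) l * ‖gradMap m v‖ ^ 2 := norm_energyMap_sq_le le_rfl (hspan hv)
        _ ≤ eigenvalue m (H2 m) l * (M * ‖gradMap m (galerkinProj m N v)‖ ^ 2) :=
            mul_le_mul_of_nonneg_left h1 hpos.le
        _ = _ := by ring
  · push Not at hinj
    obtain ⟨v, hv, hv0, hvp⟩ := hinj
    -- A nonzero $v$ with $\Pi v=0$ attains the value $\infty$; the bound is then trivial because
    -- $\lambda_m^l>0$ excludes the product $0\cdot\infty$.
    refine ⟨⊤, ⟨⟨v, ⟨hv, hv0⟩, ?_⟩, fun _ _ => le_top⟩, ?_⟩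
    · rw [projRatio_eq (hH2 hv), hvp, map_zero, norm_zero, zero_pow two_ne_zero,
        ENNReal.ofReal_zero]
      exact ENNReal.div_zero (ENNReal.ofReal_pos.2 (norm_gradMap_sq_pos (hH2 hv) hv0)).ne'
    · rw [ENNReal.mul_top (ENNReal.ofReal_pos.2 hpos).ne']
      exact le_top
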